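/- Let $\mathcal X$ be a finite set, let $\mathcal H_B$ be a finite-dimensional complex Hilbert space, let $p_X$ be a probability distribution on $\mathcal X$, and for each $x\in\mathcal X$ let $\rho_B^x$ be a density matrix on $\mathcal H_B$. Put $\rho_{XB}=\sum_{x} p_X(x)\,|x\rangle\langle x|\otimes\rho_B^x$. Logarithms are natural, suprema and infima over $\Pi$ range over POVMs $(\Pi_B^x)_{x\in\mathcal X}$ on $\mathcal H_B$ (so $\Pi_B^x\ge 0$ and $\sum_x\Pi_B^x=\mathbb 1_B$), and $\Pi_{XB}=\sum_x|x\rangle\langle x|\otimes\Pi_B^x$. For $\alpha=\infty$ read $\frac{\alpha-1}{\alpha}=\frac{\alpha}{\alpha-1}=1$. **Leakage.** For $\alpha\in(1,\infty]$ let $$\mathsf P_\alpha(X|B)_\rho=\sup_{\Pi}\operatorname{Tr}\Big[\rho_{XB}\,\Pi_{XB}^{\frac{\alpha-1}{\alpha}}\Big],\qquad \mathsf P_\alpha(X)_p=\sup_{q}\sum_x p_X(x)\,q(x)^{\frac{\alpha-1}{\alpha}},$$ with $q$ ranging over the probability distributions on $\mathcal X$. For $\alpha=1$ let $$\varepsilon_1(X|B)_\rho=\inf_{\Pi}\big(-\operatorname{Tr}[\rho_{XB}\log\Pi_{XB}]\big),\qquad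 \varepsilon_1(X)_p=\inf_{q}\Big(-\sum_x p_X(x)\log q(x)\Big)$$ be the minimal expected log-losses, where the loss is $+\infty$ unless $\operatorname{supp}\rho_{XB}\subseteq\operatorname{supp}\Pi_{XB}$, respectively $\operatorname{supp}p_X\subseteq\operatorname{supp}q$. The quantum $\alpha$-leakage is $$\mathcal L_\alpha(X\to B)_\rho=\begin{cases}\frac{\alpha}{\alpha-1}\log\dfrac{\mathsf P_\alpha(X|B)_\rho}{\mathsf P_\alpha(X)_p},&\alpha\in(1,\infty],\\[2mm] \varepsilon_1(X)_p-\varepsilon_1(X|B)_\rho,&\alpha=1.\end{cases}$$ **Entropies.** Let $H_\alpha(X)_p=\frac1{1-\alpha}\log\sum_x p_X(x)^\alpha$ for $\alpha\in(1,\infty)$, $H_1(X)_p=-\sum_x p_X(x)\log p_X(x)$ and $H_\infty(X)_p=-\log\max_x p_X(x)$. For nonnegative vectors $P,Q$ on a finite set with $\sum_iP_i=1$, let $D_\alpha(P\|Q)$ be $\frac1{\alpha-1}\log\sum_i P_i^\alpha Q_i^{1-\alpha}$ for $\alpha\in(1,\infty)$, $\sum_iP_i\log\frac{P_i}{Q_i}$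 for $\alpha=1$ and $\log\max_{i:P_i>0}\frac{P_i}{Q_i}$ for $\alpha=\infty$ if $\operatorname{supp}P\subseteq\operatorname{supp}Q$, and $+\infty$ otherwise. The measured Rényi divergence is $D_\alpha^{\mathbb M}(\rho\|\sigma)=\sup_{(M_i)_i} D_\alpha\big((\operatorname{Tr}[\rho M_i])_i\,\big\|\,(\operatorname{Tr}[\sigma M_i])_i\big)$ over all POVMs with finitely many outcomes, the measured conditional Rényi entropy is $H_\alpha^{\mathbb M}(X|B)_\rho=-\inf_{\sigma_B}D_\alpha^{\mathbb M}(\rho_{XB}\|\mathbb 1_X\otimes\sigma_B)$ over density matrices $\sigma_B$ on $\mathcal H_B$, and the measured Arimoto information is $I_\alpha^{\mathrm A,\mathbb M}(X:B)_\rho=H_\alpha(X)_p-H_\alpha^{\mathbb M}(X|B)_\rho$. **Theorem.** For every $\alpha\in[1,\infty]$, $$\mathcal L_\alpha(X\to B)_\rho=I_\alpha^{\mathrm A,\mathbb M}(X:B)_\rho=H_\alpha(X)_p-H_\alpha^{\mathbb M}(X|B)_\rho.$$ Moreover, the minimal expected log-loss equals the measured conditional entropy of order one: $\varepsilon_1(X|B)_\rho=H_1^{\mathbb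 M}(X|B)_\rho$. -/

import Mathlib

open scoped ENNReal Kronecker ComplexOrder

noncomputable section

namespace QLeakage

/-! All logarithms are natural; Hilbert spaces are finite-dimensional, with operators written as
complex matrices in a fixed orthonormal basis. -/

/-- Density matrices on `ℂ^d`: positive semidefinite of trace one. -/
structure DensityMatrix (d : Type*) [Fintype d] where
  mat : Matrix d d ℂ
  posSemidef : mat.PosSemidef
  trace_eq_one : mat.trace = 1

/-- Positive operator-valued measures on `ℂ^d` with outcomes in the finite set `ι`. -/
structure POVM (ι d : Type*) [Fintype ι] [Fintype d] [DecidableEq d] where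
  effect : ι → Matrix d d ℂ
  posSemidef : ∀ i, (effect i).PosSemidef
  sum_eq_one : ∑ i, effect i = 1

/-- Probability distributions on the finite set `X`. -/
structure ProbDist (X : Type*) [Fintype X] where
  prob : X → ℝ
  nonneg : ∀ x, 0 ≤ prob x
  sum_eq_one : ∑ x, prob x = 1

/-- The data `(p_X, (ρ_B^x)_x)` of a classical-quantum state. -/
structure CQState (X B : Type*) [Fintype X] [Fintype B] where
  dist : ProbDist X
  cond : X → DensityMatrix B

/-- The operator `∑ x, |x⟩⟨x| ⊗ A x` on `ℂ^X ⊗ ℂ^B`. -/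
def cqOperator {X B : Type*} [Fintype X] [DecidableEq X] (A : X → Matrix B B ℂ) :
    Matrix (X × B) (X × B) ℂ :=
  ∑ x, (Matrix.single x x (1 : ℂ)) ⊗ₖ (A x)

/-- The joint density matrix `ρ_XB = ∑ x, p_X(x) |x⟩⟨x| ⊗ ρ_B^x`. -/
def CQState.joint {X B : Type*} [Fintype X] [DecidableEq X] [Fintype B] (ρ : CQState X B) :
    Matrix (X × B) (X × B) ℂ :=
  cqOperator fun x => (ρ.dist.prob x : ℂ) • (ρ.cond x).mat

/-- The operator `Π_XB = ∑ x, |x⟩⟨x| ⊗ Π_B^x` of a POVM `(Π_B^x)_x`. -/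
def POVM.joint {X B : Type*} [Fintype X] [DecidableEq X] [Fintype B] [DecidableEq B]
    (M : POVM X B) : Matrix (X × B) (X × B) ℂ :=
  cqOperator M.effect

/-- `supp A ⊆ supp C` for Hermitian matrices (the support is the orthogonal complement of the
kernel): the kernel of `C` is contained in the kernel of `A`. -/
def SuppLE {d : Type*} [Fintype d] (A C : Matrix d d ℂ) : Prop :=
  ∀ v : d → ℂ, C.mulVec v = 0 → A.mulVec v = 0

/-! ### Gains, losses and the leakage -/

/-- The exponent `(α - 1) / α`, equal to `1` at `α = ∞`. -/
def gainExponent (α : ℝ≥0∞) : ℝ :=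
  if α = ∞ then 1 else (α.toReal - 1) / α.toReal

section

variable {X B : Type*} [Fintype X] [DecidableEq X] [Fintype B] [DecidableEq B]

/-- The expected `α`-gain `Tr[ρ_XB Π_XB ^ ((α - 1) / α)]`, for `α > 1`; the power is taken by
functional calculus. -/
def expectedGain (α : ℝ≥0∞) (ρ : CQState X B) (M : POVM X B) : ℝ :=
  (Matrix.trace (ρ.joint * cfc (fun t : ℝ => t ^ gainExponent α) M.joint)).re

/-- The maximal expected `α`-gain `P_α(X|B)`. -/
def maxExpectedGain (α : ℝ≥0∞) (ρ : CQState X B) : ℝ :=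
  ⨆ M : POVM X B, expectedGain α ρ M

open Classical in
/-- The expected log-loss (expected `1`-loss): `-Tr[ρ_XB log Π_XB]` if
`supp ρ_XB ⊆ supp Π_XB`, and `+∞` otherwise. As `Real.log 0 = 0`, the functional calculus takes
the logarithm on the support of `Π_XB`. -/
def expectedLogLoss (ρ : CQState X B) (M : POVM X B) : EReal :=
  if SuppLE ρ.joint M.joint then
    ((-(Matrix.trace (ρ.joint * cfc Real.log M.joint)).re : ℝ) : EReal)
  else ⊤

/-- The minimal expected log-loss `ε_1(X|B)`. -/
def minExpectedLogLoss (ρ : CQState X B) : EReal :=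
  ⨅ M : POVM X B, expectedLogLoss ρ M

end

section

variable {X : Type*} [Fintype X]

/-- The maximal expected `α`-gain without side information,
`P_α(X) = sup_q ∑ x, p(x) q(x) ^ ((α - 1) / α)`. -/
def priorMaxExpectedGain (α : ℝ≥0∞) (p : ProbDist X) : ℝ :=
  ⨆ q : ProbDist X, ∑ x, p.prob x * q.prob x ^ gainExponent α

open Classical in
/-- The expected log-loss `-∑ x, p(x) log q(x)` of the guessing distribution `q`, equal to `+∞`
unless `supp p ⊆ supp q`. -/
def priorExpectedLogLoss (p q : ProbDist X) : EReal :=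
  if ∀ x, q.prob x = 0 → p.prob x = 0 then
    ((-∑ x, p.prob x * Real.log (q.prob x) : ℝ) : EReal)
  else ⊤

/-- The minimal expected log-loss without side information, `ε_1(X)`. -/
def priorMinExpectedLogLoss (p : ProbDist X) : EReal :=
  ⨅ q : ProbDist X, priorExpectedLogLoss p q

end

open Classical in
/-- The quantum `α`-leakage `L_α(X → B)`, for `α ∈ [1, ∞]`:
`α / (α - 1) * log (P_α(X|B) / P_α(X))` if `α > 1`, and `ε_1(X) - ε_1(X|B)` if `α = 1`. -/
def alphaLeakage {X B : Type*} [Fintype X] [DecidableEq X] [Fintype B] [DecidableEq B]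
    (α : ℝ≥0∞) (ρ : CQState X B) : EReal :=
  if α = 1 then priorMinExpectedLogLoss ρ.dist - minExpectedLogLoss ρ
  else (((gainExponent α)⁻¹ *
    Real.log (maxExpectedGain α ρ / priorMaxExpectedGain α ρ.dist) : ℝ) : EReal)

/-! ### Entropic quantities -/

open Classical in
/-- The classical Rényi divergence `D_α(p‖q)` of order `α ∈ [1, ∞]` between nonnegative vectors
on a finite set, where `p` is normalized. -/
def renyiDiv {ι : Type*} [Fintype ι] (α : ℝ≥0∞) (p q : ι → ℝ) : EReal :=
  if ∀ i, q i = 0 → p i = 0 then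
    if α = 1 then ((∑ i, p i * Real.log (p i / q i) : ℝ) : EReal)
    else if α = ∞ then ((Real.log (⨆ i, p i / q i) : ℝ) : EReal)
    else ((1 / (α.toReal - 1) *
      Real.log (∑ i, p i ^ α.toReal * q i ^ (1 - α.toReal)) : ℝ) : EReal)
  else ⊤

/-- The measured Rényi divergence `D_α^M(ρ‖σ)`: the supremum of the classical divergences of the
outcome distributions `Tr[ρ M_i]`, `Tr[σ M_i]` over all POVMs with finitely many outcomes. -/
def measuredRenyiDiv {d : Type*} [Fintype d] [DecidableEq d] (α : ℝ≥0∞) (ρ σ : Matrix d d ℂ) :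
    EReal :=
  ⨆ (n : ℕ) (M : POVM (Fin n) d),
    renyiDiv α (fun i => (Matrix.trace (ρ * M.effect i)).re)
      (fun i => (Matrix.trace (σ * M.effect i)).re)

/-- The Rényi entropy `H_α(X)_p`, for `α ∈ [1, ∞]`. -/
def renyiEntropy {X : Type*} [Fintype X] (α : ℝ≥0∞) (p : ProbDist X) : ℝ :=
  if α = 1 then -∑ x, p.prob x * Real.log (p.prob x)
  else if α = ∞ then -Real.log (⨆ x, p.prob x)
  else 1 / (1 - α.toReal) * Real.log (∑ x, p.prob x ^ α.toReal)

section

variable {X B : Type*} [Fintype X] [DecidableEq X] [Fintype B] [DecidableEq B]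

/-- The measured conditional Rényi entropy
`H_α^M(X|B)_ρ = -inf_σ D_α^M(ρ_XB ‖ 1_X ⊗ σ_B)`, over density matrices `σ_B`. -/
def measuredCondEntropy (α : ℝ≥0∞) (ρ : CQState X B) : EReal :=
  -⨅ σ : DensityMatrix B, measuredRenyiDiv α ρ.joint ((1 : Matrix X X ℂ) ⊗ₖ σ.mat)

/-- The measured Arimoto information `I_α^{A,M}(X:B)_ρ = H_α(X)_p - H_α^M(X|B)_ρ`. -/
def measuredArimotoInfo (α : ℝ≥0∞) (ρ : CQState X B) : EReal :=
  (renyiEntropy α ρ.dist : EReal) - measuredCondEntropy α ρ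

end

end QLeakage

end

/-! Write β for `gainExponent α` and G for the maximal gain. For α > 1 the crux is inf_σ D_α^M(ρ_XB
‖ 1 ⊗ σ) = β⁻¹ log G; the prior term is the classical analogue with reference vector 1.

Lower bound: measure in an eigenbasis of Π_XB, with eigenvalues μ. The gain becomes ∑ P_i μ_i^β,
while ∑ Q_i μ_i = Tr[(1 ⊗ σ) Π_XB] = 1 for every σ, so Hölder bounds it by the divergence
(`sum_mul_rpow_le_exp`).

Upper bound: D_α(P‖Q) ≤ β⁻¹ log G follows from ∑ P_i c_i^β ≤ G(1 - β) + Gβ ∑ Q_i c_i for all c > 0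
(`renyiDiv_le_of_forall_sum_rpow_le`), so one σ must serve all measurements and weights. Pinching
and operator Jensen replace (M, c) by a block-diagonal ω = ∑ c_i M_i. The bound is affine in σ and
concave in ω, so by minimax σ may depend on ω (`exists_density_forall_sum_le`). For fixed ω, let r
be the largest eigenvalue of ∑ ω_x and σ a top eigenprojection: ω/r lies below a POVM, so Tr[ρ_XB
ω^β] ≤ r^β G, and Bernoulli's r^β ≤ 1 + β(r - 1) concludes.

Order one runs in parallel, with log for the power and log r ≤ r - 1 for Bernoulli. -/

namespace QLeakage

open Matrix

/-! ### Spectral decompositions as measurements -/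

section Spectral

variable {d : Type*} [Fintype d] [DecidableEq d]

/-- There is one rank-one projection per eigenvector, even for repeated eigenvalues. Each thus has
trace one and can serve as a density matrix, and a single family diagonalizes `cfc f W` for all `f`.
-/
theorem exists_spectral_povm {W : Matrix d d ℂ} (hW : W.IsHermitian) :
    ∃ (μ : d → ℝ) (E : POVM d d),
      (∀ k l, E.effect k * E.effect l = if k = l then E.effect k else 0) ∧
      (∀ k, (E.effect k).trace = 1) ∧
      (∀ f : ℝ → ℝ, cfc f W = ∑ k, f (μ k) • E.effect k) ∧
      (W = ∑ k, μ k • E.effect k) ∧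
      (W.PosSemidef → ∀ k, 0 ≤ μ k) ∧ (W.PosDef → ∀ k, 0 < μ k) := by
  let U : Matrix d d ℂ := Subtype.val hW.eigenvectorUnitary
  have hU1 : star U * U = 1 := Unitary.coe_star_mul_self _
  have hU2 : U * star U = 1 := Unitary.coe_mul_star_self _
  have hdiag : ∀ g : d → ℝ, U * diagonal (fun k => (g k : ℂ)) * star U =
      ∑ k, g k • (U * single k k (1 : ℂ) * star U) := by
    intro g
    rw [← Matrix.sum_single_eq_diagonal, Finset.mul_sum, Finset.sum_mul]
    refine Finset.sum_congr rfl fun k _ => ?_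
    rw [← smul_mul_assoc, ← mul_smul_comm, Matrix.smul_single]
    simp
  have hone : ∑ k, U * single k k (1 : ℂ) * star U = 1 := by
    have := hdiag 1
    simp only [Pi.one_apply, Complex.ofReal_one, one_smul] at this
    rw [← this, Matrix.diagonal_one, mul_one, hU2]
  have hpos : ∀ k, (U * single k k (1 : ℂ) * star U).PosSemidef := by
    intro k
    refine PosSemidef.mul_mul_conjTranspose_same ?_ U
    rw [← Matrix.diagonal_single]
    refine PosSemidef.diagonal ?_
    intro i
    by_cases h : i = k
    · subst h; simp
    · simp [h]
  have hf : ∀ f : ℝ → ℝ, cfc f W = ∑ k, f (hW.eigenvalues k) • (U * single k k (1 : ℂ) * star U) := by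
    intro f
    rw [hW.cfc_eq, IsHermitian.cfc, Unitary.conjStarAlgAut_apply]
    exact hdiag fun k => f (hW.eigenvalues k)
  refine ⟨hW.eigenvalues, ⟨_, hpos, hone⟩, ?_, fun k => ?_, hf, ?_, fun h k => ?_, fun h k => ?_⟩
  · intro k l
    have : U * single k k (1 : ℂ) * star U * (U * single l l (1 : ℂ) * star U) =
        U * (single k k (1 : ℂ) * single l l (1 : ℂ)) * star U := by
      calc _ = U * single k k (1 : ℂ) * (star U * U) * single l l (1 : ℂ) * star U := by
            simp only [mul_assoc]
        _ = _ := by rw [hU1, mul_one]; simp only [mul_assoc]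
    change U * single k k (1 : ℂ) * star U * (U * single l l (1 : ℂ) * star U) = _
    rw [this]
    split_ifs with h
    · subst h; simp
    · simp [single_mul_single_of_ne, h]
  · rw [trace_mul_comm, ← mul_assoc, hU1, one_mul, trace_single_eq_same]
  · have := hf id
    rwa [cfc_id ℝ W hW.isSelfAdjoint] at this
  · exact h.eigenvalues_nonneg k
  · exact h.eigenvalues_pos k

theorem re_trace_mul_nonneg {A C : Matrix d d ℂ} (hA : A.PosSemidef) (hC : C.PosSemidef) :
    0 ≤ (trace (A * C)).re := by
  open scoped MatrixOrder in
  obtain ⟨D, rfl⟩ := (CStarAlgebra.nonneg_iff_eq_star_mul_self).mp hA.nonneg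
  rw [mul_assoc, trace_mul_comm, mul_assoc, ← mul_assoc]
  have := (hC.mul_mul_conjTranspose_same D).trace_nonneg
  exact (Complex.le_def.mp this).1

theorem re_trace_mul_sum_smul {ι : Type*} (s : Finset ι) (A : Matrix d d ℂ) (c : ι → ℝ)
    (M : ι → Matrix d d ℂ) :
    (trace (A * ∑ i ∈ s, c i • M i)).re = ∑ i ∈ s, (trace (A * M i)).re * c i := by
  simp [Finset.mul_sum, trace_sum, Complex.re_sum, mul_comm]

end Spectral

/-! ### Operator Jensen for the resolvent -/

section Resolvent

variable {d : Type*} [Fintype d] [DecidableEq d] {ι : Type*} [Fintype ι]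

/-- Completing the square: with R = W⁻¹, the difference equals ∑ c_i⁻¹ (1 - c_i R) M_i (1 - c_i R)ᴴ
+ R (W - ∑ c_i M_i) Rᴴ, because the effects sum to 1. -/
theorem POVM.posSemidef_sum_inv_smul_sub (M : POVM ι d) {c : ι → ℝ} (hc : ∀ i, 0 < c i)
    {W R : Matrix d d ℂ} (hR : R.IsHermitian) (hRW : R * W = 1)
    (hW : (W - ∑ i, c i • M.effect i).PosSemidef) :
    (∑ i, (c i)⁻¹ • M.effect i - R).PosSemidef := by
  have key : ∑ i, (c i)⁻¹ • M.effect i - R =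
      ∑ i, (c i)⁻¹ • ((1 - c i • R) * M.effect i * (1 - c i • R)ᴴ) +
        R * (W - ∑ i, c i • M.effect i) * Rᴴ := by
    have h1 : ∀ i, (c i)⁻¹ • ((1 - c i • R) * M.effect i * (1 - c i • R)ᴴ) =
        (c i)⁻¹ • M.effect i - R * M.effect i - M.effect i * R +
          R * (c i • M.effect i) * R := by
      intro i
      have hci := (hc i).ne'
      rw [conjTranspose_sub, conjTranspose_smul, hR.eq, conjTranspose_one, star_trivial]
      simp only [sub_mul, mul_sub, one_mul, mul_one, smul_sub, smul_mul_assoc, mul_smul_comm,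
        smul_smul, inv_mul_cancel₀ hci, one_smul]
      rw [← mul_assoc, inv_mul_cancel₀ hci, one_mul]
      abel
    rw [Finset.sum_congr rfl fun i _ => h1 i]
    simp only [Finset.sum_add_distrib, Finset.sum_sub_distrib, ← Finset.mul_sum,
      ← Finset.sum_mul, M.sum_eq_one, hR.eq, mul_sub, sub_mul, hRW, one_mul, mul_one]
    abel
  rw [key]
  refine PosSemidef.add (posSemidef_sum _ fun i _ => ?_) (hW.mul_mul_conjTranspose_same R)
  exact ((M.posSemidef i).mul_mul_conjTranspose_same _).smul (inv_nonneg.2 (hc i).le)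

theorem POVM.sum_add_smul (N : POVM ι d) (s : ℝ) (g : ι → ℝ) :
    ∑ i, (s + g i) • N.effect i = s • (1 : Matrix d d ℂ) + ∑ i, g i • N.effect i := by
  simp only [add_smul, Finset.sum_add_distrib, ← Finset.smul_sum, N.sum_eq_one]

/-- If `W = ∑ k, μ k • E k` is a spectral decomposition and `∑ i, c i • M i ≤ W`, then
`(s + W)⁻¹ ≤ ∑ i, (s + c i)⁻¹ • M i`, tested against `A ≥ 0`. -/
theorem POVM.sum_resolvent_le (M : POVM ι d) {c : ι → ℝ} (hc : ∀ i, 0 ≤ c i)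
    {μ : d → ℝ} (hμ : ∀ k, 0 ≤ μ k) (E : POVM d d)
    (hE : ∀ k l, E.effect k * E.effect l = if k = l then E.effect k else 0)
    (hW : (∑ k, μ k • E.effect k - ∑ i, c i • M.effect i).PosSemidef)
    {A : Matrix d d ℂ} (hA : A.PosSemidef) {s : ℝ} (hs : 0 < s) :
    ∑ k, (trace (A * E.effect k)).re * (s + μ k)⁻¹ ≤
      ∑ i, (trace (A * M.effect i)).re * (s + c i)⁻¹ := by
  have hR : (∑ k, (s + μ k)⁻¹ • E.effect k).IsHermitian :=
    (posSemidef_sum _ fun k _ => (E.posSemidef k).smul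
      (inv_nonneg.2 (add_nonneg hs.le (hμ k)))).isHermitian
  have hRW : (∑ k, (s + μ k)⁻¹ • E.effect k) * (∑ k, (s + μ k) • E.effect k) = 1 := by
    rw [← E.sum_eq_one, Finset.sum_mul]
    refine Finset.sum_congr rfl fun k _ => ?_
    have : s + μ k ≠ 0 := (add_pos_of_pos_of_nonneg hs (hμ k)).ne'
    simp [Finset.mul_sum, hE, smul_smul, this]
  have := M.posSemidef_sum_inv_smul_sub (c := fun i => s + c i)
    (fun i => add_pos_of_pos_of_nonneg hs (hc i)) hR hRW (by
      rw [E.sum_add_smul, M.sum_add_smul, add_sub_add_left_eq_sub]; exact hW)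
  have h := re_trace_mul_nonneg hA this
  rw [mul_sub, trace_sub, Complex.sub_re, re_trace_mul_sum_smul, re_trace_mul_sum_smul] at h
  exact sub_nonneg.1 h

theorem POVM.sum_re_trace (M : POVM ι d) (A : Matrix d d ℂ) :
    ∑ i, (trace (A * M.effect i)).re = (trace A).re := by
  rw [← Complex.re_sum, ← trace_sum, ← Finset.mul_sum, M.sum_eq_one, mul_one]

end Resolvent

/-! ### From resolvents to powers and the logarithm -/

section Scalar

variable {ι κ : Type*} [Fintype ι] [Fintype κ]

open Real MeasureTheory Set in
theorem integrableOn_sum_mul_rpowIntegrand {p : ℝ} (hp : p ∈ Ioo 0 1) (u : ι → ℝ) {v : ι → ℝ}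
    (hv : ∀ i, 0 ≤ v i) :
    IntegrableOn (fun t => ∑ i, u i * rpowIntegrand₀₁ p t (v i)) (Ioi 0) :=
  integrable_finsetSum _ fun i _ => (integrableOn_rpowIntegrand₀₁_Ioi hp (hv i)).const_mul (u i)

open Real MeasureTheory Set in
theorem sum_mul_rpow_eq_integral {p : ℝ} (hp : p ∈ Ioo 0 1) (u : ι → ℝ) {v : ι → ℝ}
    (hv : ∀ i, 0 ≤ v i) :
    ∑ i, u i * v i ^ p = (∫ t in Ioi 0, rpowIntegrand₀₁ p t 1)⁻¹ *
      ∫ t in Ioi 0, ∑ i, u i * rpowIntegrand₀₁ p t (v i) := by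
  rw [integral_finsetSum _ fun i _ =>
    (integrableOn_rpowIntegrand₀₁_Ioi hp (hv i)).const_mul (u i), Finset.mul_sum]
  refine Finset.sum_congr rfl fun i _ => ?_
  rw [rpow_eq_const_mul_integral hp (hv i), integral_const_mul]
  ring

open Real in
theorem sum_mul_rpowIntegrand (p s : ℝ) (u v : ι → ℝ) :
    ∑ i, u i * rpowIntegrand₀₁ p s (v i) =
      s ^ p * (s⁻¹ * ∑ i, u i - ∑ i, u i * (s + v i)⁻¹) := by
  rw [Finset.mul_sum, ← Finset.sum_sub_distrib, Finset.mul_sum]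
  refine Finset.sum_congr rfl fun i _ => ?_
  rw [rpowIntegrand₀₁]; ring

-- The power t^p is a positive mixture over s > 0 of s^p (s⁻¹ - (s + t)⁻¹). The resolvents enter
-- with a minus sign, and equal total masses cancel the s⁻¹ terms.
open Real MeasureTheory Set in
theorem sum_mul_rpow_le_of_resolvent_le {p : ℝ} (hp : p ∈ Ioo 0 1) {a μ : κ → ℝ} {b c : ι → ℝ}
    (hμ : ∀ k, 0 ≤ μ k) (hc : ∀ i, 0 ≤ c i) (hab : ∑ k, a k = ∑ i, b i)
    (h : ∀ s : ℝ, 0 < s → ∑ k, a k * (s + μ k)⁻¹ ≤ ∑ i, b i * (s + c i)⁻¹) :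
    ∑ i, b i * c i ^ p ≤ ∑ k, a k * μ k ^ p := by
  rw [sum_mul_rpow_eq_integral hp b hc, sum_mul_rpow_eq_integral hp a hμ]
  refine mul_le_mul_of_nonneg_left ?_ (inv_nonneg.2 (integral_rpowIntegrand₀₁_one_pos hp).le)
  refine setIntegral_mono_on (integrableOn_sum_mul_rpowIntegrand hp b hc)
    (integrableOn_sum_mul_rpowIntegrand hp a hμ) measurableSet_Ioi fun s hs => ?_
  have hs : 0 < s := hs
  rw [sum_mul_rpowIntegrand, sum_mul_rpowIntegrand, hab]
  have := h s hs
  gcongr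

open Real Set Filter Topology in
theorem tendsto_sum_mul_rpow_sub (u : ι → ℝ) {v : ι → ℝ} (hv : ∀ i, 0 < v i) :
    Tendsto (fun p : ℝ => p⁻¹ * (∑ i, u i * v i ^ p - ∑ i, u i)) (𝓝[>] 0)
      (𝓝 (∑ i, u i * log (v i))) := by
  have : ∀ i, Tendsto (fun p : ℝ => u i * (p⁻¹ * (v i ^ p - 1))) (𝓝[>] 0)
      (𝓝 (u i * log (v i))) := fun i => by
    have h1 : HasDerivAt (fun p : ℝ => v i ^ p) (log (v i)) 0 := by
      simpa using (hasDerivAt_id (0 : ℝ)).const_rpow (hv i)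
    have h2 := (hasDerivAt_iff_tendsto_slope.1 h1).mono_left
      (nhdsWithin_mono 0 (fun x (hx : 0 < x) => hx.ne') : 𝓝[>] (0 : ℝ) ≤ 𝓝[≠] 0)
    simpa [slope_fun_def] using h2.const_mul (u i)
  refine (tendsto_finsetSum _ fun i _ => this i).congr fun p => ?_
  rw [← Finset.sum_sub_distrib, Finset.mul_sum]
  exact Finset.sum_congr rfl fun i _ => by ring

-- The logarithm is the limit of (t^p - 1)/p as p ↓ 0; equal total masses cancel the constants.
open Real Set Filter in
theorem sum_mul_log_le_of_sum_mul_rpow_le {a μ : κ → ℝ} {b c : ι → ℝ}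
    (hμ : ∀ k, 0 < μ k) (hc : ∀ i, 0 < c i) (hab : ∑ k, a k = ∑ i, b i)
    (h : ∀ p ∈ Ioo (0 : ℝ) 1, ∑ i, b i * c i ^ p ≤ ∑ k, a k * μ k ^ p) :
    ∑ i, b i * log (c i) ≤ ∑ k, a k * log (μ k) := by
  refine le_of_tendsto_of_tendsto (tendsto_sum_mul_rpow_sub b hc) (tendsto_sum_mul_rpow_sub a hμ) ?_
  filter_upwards [Ioo_mem_nhdsGT one_pos] with p hp
  have := h p hp
  have := hp.1
  rw [hab]
  gcongr

end Scalar

/-- The operator Jensen inequality `∑ i, f (c i) • M i ≤ f W` for all measurements `M`, all weights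
`c i > 0` and all positive semidefinite `W ≥ ∑ i, c i • M i` on `ℂ^d`. -/
def OperatorJensen (d : Type*) [Fintype d] [DecidableEq d] (f : ℝ → ℝ) : Prop :=
  ∀ (n : ℕ) (M : POVM (Fin n) d) (c : Fin n → ℝ), (∀ i, 0 < c i) →
    ∀ W : Matrix d d ℂ, W.PosSemidef → (W - ∑ i, c i • M.effect i).PosSemidef →
    ∀ A : Matrix d d ℂ, A.PosSemidef →
      ∑ i, (trace (A * M.effect i)).re * f (c i) ≤ (trace (A * cfc f W)).re

/-! ### Operator Jensen and operator concavity -/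

section Jensen

variable {d : Type*} [Fintype d] [DecidableEq d]

theorem operatorJensen_rpow {p : ℝ} (hp0 : 0 < p) (hp1 : p ≤ 1) :
    OperatorJensen d fun t => t ^ p := by
  intro n M c hc W hW hWM A hA
  -- The exponent 1, needed at α = ∞, lies outside the integral representation; there the claim is
  -- the assumed operator inequality itself.
  obtain rfl | hp1 := hp1.eq_or_lt
  · have hid : cfc (fun t : ℝ => t ^ (1 : ℝ)) W = W := by
      simp only [Real.rpow_one]
      exact cfc_id' ℝ W hW.isHermitian.isSelfAdjoint
    rw [hid]
    have := re_trace_mul_nonneg hA hWM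
    rw [mul_sub, trace_sub, Complex.sub_re, re_trace_mul_sum_smul] at this
    simpa using sub_nonneg.1 this
  · obtain ⟨μ, E, hE, -, hf, hWE, hμ, -⟩ := exists_spectral_povm hW.isHermitian
    rw [hf, re_trace_mul_sum_smul]
    refine sum_mul_rpow_le_of_resolvent_le ⟨hp0, hp1⟩ (hμ hW) (fun i => (hc i).le)
      (by rw [E.sum_re_trace, M.sum_re_trace]) fun s hs => ?_
    exact M.sum_resolvent_le (fun i => (hc i).le) (hμ hW) E hE (hWE ▸ hWM) hA hs

/-- The sum dominates δ times the identity, δ being the smallest weight. -/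
theorem POVM.posDef_sum_smul {ι : Type*} [Fintype ι] (M : POVM ι d) {c : ι → ℝ}
    (hc : ∀ i, 0 < c i) : (∑ i, c i • M.effect i).PosDef := by
  obtain ⟨δ, hδ, hle⟩ : ∃ δ : ℝ, 0 < δ ∧ ∀ i, δ ≤ c i := by
    cases isEmpty_or_nonempty ι
    · exact ⟨1, one_pos, fun i => isEmptyElim i⟩
    · obtain ⟨i, hi⟩ := Finite.exists_min c
      exact ⟨c i, hc i, hi⟩
  have : ∑ i, c i • M.effect i = δ • 1 + ∑ i, (c i - δ) • M.effect i := by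
    simp [sub_smul, ← Finset.smul_sum, M.sum_eq_one]
  rw [this]
  exact (PosDef.one.smul hδ).add_posSemidef
    (posSemidef_sum _ fun i _ => (M.posSemidef i).smul (sub_nonneg.2 (hle i)))

theorem operatorJensen_log : OperatorJensen d Real.log := by
  intro n M c hc W hW hWM A hA
  have hWpos : W.PosDef := by
    simpa using PosDef.posSemidef_add hWM (M.posDef_sum_smul hc)
  obtain ⟨μ, E, hE, -, hf, hWE, -, hμ⟩ := exists_spectral_povm hW.isHermitian
  rw [hf, re_trace_mul_sum_smul]
  refine sum_mul_log_le_of_sum_mul_rpow_le (hμ hWpos) hc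
    (by rw [E.sum_re_trace, M.sum_re_trace]) fun p hp => ?_
  refine sum_mul_rpow_le_of_resolvent_le hp (fun k => (hμ hWpos k).le) (fun i => (hc i).le)
    (by rw [E.sum_re_trace, M.sum_re_trace]) fun s hs => ?_
  exact M.sum_resolvent_le (fun i => (hc i).le) (fun k => (hμ hWpos k).le) E hE (hWE ▸ hWM) hA hs

/-- Relabelling of the outcomes of a measurement. -/
def POVM.reindex {ι κ : Type*} [Fintype ι] [Fintype κ] (e : κ ≃ ι) (M : POVM ι d) : POVM κ d where
  effect k := M.effect (e k)
  posSemidef k := M.posSemidef (e k)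
  sum_eq_one := (e.sum_comp M.effect).trans M.sum_eq_one

theorem OperatorJensen.sum_le {f : ℝ → ℝ} (hf : OperatorJensen d f) {ι : Type*} [Fintype ι]
    (M : POVM ι d) {c : ι → ℝ} (hc : ∀ i, 0 < c i) {W : Matrix d d ℂ} (hW : W.PosSemidef)
    (hWM : (W - ∑ i, c i • M.effect i).PosSemidef) {A : Matrix d d ℂ} (hA : A.PosSemidef) :
    ∑ i, (trace (A * M.effect i)).re * f (c i) ≤ (trace (A * cfc f W)).re := by
  let e := (Fintype.equivFin ι).symm
  have := hf _ (M.reindex e) (c ∘ e) (fun i => hc _) W hW (by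
    rw [← e.sum_comp] at hWM; exact hWM) A hA
  rwa [← e.sum_comp]

theorem OperatorJensen.concaveOn {f : ℝ → ℝ} (hf : OperatorJensen d f) {A : Matrix d d ℂ}
    (hA : A.PosSemidef) :
    ConcaveOn ℝ {W : Matrix d d ℂ | W.PosDef} fun W => (trace (A * cfc f W)).re := by
  have hconv : ∀ W : Matrix d d ℂ, W.PosDef → ∀ V : Matrix d d ℂ, V.PosDef → ∀ a b : ℝ, 0 ≤ a →
      0 ≤ b → a + b = 1 → (a • W + b • V).PosDef := by
    intro W hW V hV a b ha hb hab
    obtain rfl | ha := ha.eq_or_lt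
    · simpa [show b = 1 by linarith] using hV
    · exact (hW.smul ha).add_posSemidef (hV.posSemidef.smul hb)
  refine ⟨fun W hW V hV a b ha hb hab => hconv W hW V hV a b ha hb hab,
    fun W hW V hV a b ha hb hab => ?_⟩
  have hWV := hconv W hW V hV a b ha hb hab
  obtain ⟨μ, E, -, -, hfW, hWE, -, hμ⟩ := exists_spectral_povm hW.isHermitian
  obtain ⟨ν, F, -, -, hfV, hVF, -, hν⟩ := exists_spectral_povm hV.isHermitian
  -- Mixing the spectral measurements of `W` and `V` with probabilities `a` and `b`, and weighting
  -- by eigenvalues, gives exactly `a • W + b • V`; Jensen for this measurement is concavity.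
  let N : POVM (d ⊕ d) d :=
    { effect := Sum.elim (fun k => a • E.effect k) (fun k => b • F.effect k)
      posSemidef := by
        rintro (k | k)
        · exact (E.posSemidef k).smul ha
        · exact (F.posSemidef k).smul hb
      sum_eq_one := by
        simp [← Finset.smul_sum, E.sum_eq_one, F.sum_eq_one, ← add_smul, hab] }
  have := hf.sum_le N (c := Sum.elim μ ν) (by rintro (k | k); exacts [hμ hW k, hν hV k])
    hWV.posSemidef (by
      have : ∑ i, Sum.elim μ ν i • N.effect i = a • W + b • V := by
        simp only [Fintype.sum_sum_type, Sum.elim_inl, Sum.elim_inr, N]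
        rw [hWE, hVF, Finset.smul_sum, Finset.smul_sum]
        simp only [smul_comm a, smul_comm b]
      rw [this, sub_self]; exact PosSemidef.zero) hA
  refine le_trans (le_of_eq ?_) this
  simp only [Fintype.sum_sum_type, Sum.elim_inl, Sum.elim_inr, N, hfW, hfV, re_trace_mul_sum_smul]
  simp [Finset.mul_sum, trace_smul]
  congr 1 <;> exact Finset.sum_congr rfl fun _ _ => by ring

end Jensen

/-! ### Block-diagonal operators and pinching -/

section ClassicalQuantum

variable {X B : Type*} [Fintype X] [DecidableEq X]

/-- The diagonal blocks of an operator on `ℂ^X ⊗ ℂ^B`. -/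
def diagBlock (N : Matrix (X × B) (X × B) ℂ) (x : X) : Matrix B B ℂ :=
  N.submatrix (Prod.mk x) (Prod.mk x)

theorem cqOperator_apply (A : X → Matrix B B ℂ) (i j : X × B) :
    cqOperator A i j = if i.1 = j.1 then A i.1 i.2 j.2 else 0 := by
  obtain ⟨x, b⟩ := i
  obtain ⟨y, b'⟩ := j
  simp only [cqOperator, Matrix.sum_apply, kroneckerMap_apply, single_apply]
  by_cases h : x = y
  · subst h; simp
  · rw [if_neg h]
    exact Finset.sum_eq_zero fun z _ => by
      rw [if_neg (by rintro ⟨rfl, h'⟩; exact h h'), zero_mul]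

theorem cqOperator_add (A C : X → Matrix B B ℂ) :
    cqOperator (A + C) = cqOperator A + cqOperator C := by
  simp [cqOperator, kronecker_add, Finset.sum_add_distrib]

theorem cqOperator_sub (A C : X → Matrix B B ℂ) :
    cqOperator (A - C) = cqOperator A - cqOperator C := by
  ext i j; simp only [cqOperator_apply, Matrix.sub_apply, Pi.sub_apply]; split_ifs <;> simp

theorem cqOperator_smul (c : ℝ) (A : X → Matrix B B ℂ) :
    cqOperator (c • A) = c • cqOperator A := by
  ext i j; simp only [cqOperator_apply, Matrix.smul_apply, Pi.smul_apply]; split_ifs <;> simp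

theorem cqOperator_sum {ι : Type*} (s : Finset ι) (A : ι → X → Matrix B B ℂ) :
    cqOperator (fun x => ∑ i ∈ s, A i x) = ∑ i ∈ s, cqOperator (A i) := by
  ext i j; simp only [cqOperator_apply, Matrix.sum_apply]; split_ifs <;> simp

theorem cqOperator_const [DecidableEq B] (σ : Matrix B B ℂ) :
    cqOperator (fun _ : X => σ) = (1 : Matrix X X ℂ) ⊗ₖ σ := by
  ext i j; simp [cqOperator_apply, one_apply]

theorem cqOperator_one [DecidableEq B] : cqOperator (fun _ : X => (1 : Matrix B B ℂ)) = 1 := by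
  rw [cqOperator_const, one_kronecker_one]

theorem diagBlock_cqOperator (A : X → Matrix B B ℂ) (x : X) : diagBlock (cqOperator A) x = A x := by
  ext b b'; simp [diagBlock, cqOperator_apply]

variable [Fintype B]

theorem cqOperator_mul (A C : X → Matrix B B ℂ) :
    cqOperator A * cqOperator C = cqOperator fun x => A x * C x := by
  ext i j
  rw [mul_apply, Fintype.sum_prod_type]
  simp only [cqOperator_apply, mul_apply]
  rw [Finset.sum_eq_single i.1 (fun y _ hy => by simp [hy.symm]) (by simp)]
  split_ifs <;> simp_all

theorem trace_cqOperator_mul (A : X → Matrix B B ℂ) (N : Matrix (X × B) (X × B) ℂ) :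
    (cqOperator A * N).trace = ∑ x, (A x * diagBlock N x).trace := by
  simp only [trace, diag, mul_apply, Fintype.sum_prod_type, cqOperator_apply, diagBlock,
    submatrix_apply]
  refine Finset.sum_congr rfl fun x _ => Finset.sum_congr rfl fun b _ => ?_
  rw [Finset.sum_eq_single x (fun y _ hy => by simp [hy.symm]) (by simp)]
  simp

theorem posSemidef_cqOperator {A : X → Matrix B B ℂ} (hA : ∀ x, (A x).PosSemidef) :
    (cqOperator A).PosSemidef := by
  classical
  refine posSemidef_sum _ fun x _ => PosSemidef.kronecker ?_ (hA x)
  rw [← Matrix.diagonal_single]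
  exact PosSemidef.diagonal (Pi.single_nonneg.2 zero_le_one)

theorem posDef_cqOperator [DecidableEq B] {A : X → Matrix B B ℂ} (hA : ∀ x, (A x).PosDef) :
    (cqOperator A).PosDef := by
  rw [(posSemidef_cqOperator fun x => (hA x).posSemidef).posDef_iff_isUnit]
  refine IsUnit.of_mul_eq_one (cqOperator fun x => (A x)⁻¹) ?_
  rw [cqOperator_mul, ← cqOperator_one]
  congr 1
  ext1 x
  exact Matrix.mul_nonsing_inv _ ((Matrix.isUnit_iff_isUnit_det _).1 (hA x).isUnit)

/-- The measurement with outcomes restricted to the diagonal block `x`. -/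
def POVM.diagBlock [DecidableEq B] {ι : Type*} [Fintype ι] (M : POVM ι (X × B)) (x : X) :
    POVM ι B where
  effect i := QLeakage.diagBlock (M.effect i) x
  posSemidef i := (M.posSemidef i).submatrix _
  sum_eq_one := by
    have : ∑ i, QLeakage.diagBlock (M.effect i) x = QLeakage.diagBlock (∑ i, M.effect i) x := by
      ext b b'; simp [QLeakage.diagBlock, Matrix.sum_apply]
    rw [this, M.sum_eq_one]
    ext b b'; simp [QLeakage.diagBlock, one_apply]

/-- The block-diagonal part of a measurement. -/
def POVM.pinching [DecidableEq B] {ι : Type*} [Fintype ι] (M : POVM ι (X × B)) :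
    POVM ι (X × B) where
  effect i := cqOperator fun x => (M.diagBlock x).effect i
  posSemidef i := posSemidef_cqOperator fun x => (M.diagBlock x).posSemidef i
  sum_eq_one := by
    rw [← cqOperator_sum]
    simp only [(M.diagBlock _).sum_eq_one, cqOperator_one]

/-- Both ρ_XB and 1 ⊗ σ are block-diagonal, so off-diagonal blocks of the effects never affect the
outcome statistics. -/
theorem trace_cqOperator_mul_pinching [DecidableEq B] {ι : Type*} [Fintype ι] (M : POVM ι (X × B))
    (A : X → Matrix B B ℂ) (i : ι) :
    (cqOperator A * M.pinching.effect i).trace = (cqOperator A * M.effect i).trace := by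
  rw [trace_cqOperator_mul, trace_cqOperator_mul]
  simp [POVM.pinching, diagBlock_cqOperator, POVM.diagBlock]

theorem CQState.posSemidef_joint (ρ : CQState X B) : ρ.joint.PosSemidef := by
  refine posSemidef_cqOperator fun x => (ρ.cond x).posSemidef.smul ?_
  exact_mod_cast ρ.dist.nonneg x

theorem CQState.trace_joint (ρ : CQState X B) : ρ.joint.trace = 1 := by
  classical
  rw [← mul_one ρ.joint, ← cqOperator_one, CQState.joint, trace_cqOperator_mul]
  simp only [diagBlock_cqOperator, mul_one, trace_smul, (ρ.cond _).trace_eq_one, smul_eq_mul]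
  exact_mod_cast ρ.dist.sum_eq_one

theorem POVM.posSemidef_joint [DecidableEq B] (M : POVM X B) : M.joint.PosSemidef :=
  posSemidef_cqOperator M.posSemidef

theorem ProbDist.nonempty {X : Type*} [Fintype X] (p : ProbDist X) : Nonempty X := by
  by_contra h
  rw [not_nonempty_iff] at h
  simpa using p.sum_eq_one

theorem DensityMatrix.nonempty {B : Type*} [Fintype B] (σ : DensityMatrix B) : Nonempty B := by
  by_contra h
  rw [not_nonempty_iff] at h
  simpa [trace] using σ.trace_eq_one

end ClassicalQuantum

/-! ### A minimax principle -/

section Minimax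

/-- Compactness reduces to finitely many y_j. If no x served them all, Sion's theorem over the
simplex would give weights whose averaged constraint is positive on all of `K`; concavity of `h`
would then make the barycentre of the y_j contradict `hY`. Hence `V` needs no topology. -/
theorem exists_forall_add_le_zero {E V : Type*} [TopologicalSpace E] [AddCommGroup E] [Module ℝ E]
    [IsTopologicalAddGroup E] [ContinuousSMul ℝ E] [AddCommGroup V] [Module ℝ V]
    {K : Set E} (hKne : K.Nonempty) (hKc : IsCompact K) (hKconv : Convex ℝ K)
    {Y : Set V} {h : V → ℝ} (hh : ConcaveOn ℝ Y h) (l : V →ₗ[ℝ] E →ₗ[ℝ] ℝ)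
    (hl : ∀ y, Continuous (l y)) (hY : ∀ y ∈ Y, ∃ x ∈ K, h y + l y x ≤ 0) :
    ∃ x ∈ K, ∀ y ∈ Y, h y + l y x ≤ 0 := by
  classical
  have hcl : ∀ y : Y, IsClosed {x | h y + l y x ≤ 0} := fun y =>
    isClosed_le (continuous_const.add (hl y)) continuous_const
  suffices hne : (K ∩ ⋂ y : Y, {x | h y + l y x ≤ 0}).Nonempty by
    obtain ⟨x, hx, hxY⟩ := hne
    exact ⟨x, hx, fun y hy => Set.mem_iInter.1 hxY ⟨y, hy⟩⟩
  refine hKc.inter_iInter_nonempty _ hcl fun u => ?_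
  by_contra hu
  -- A violated constraint is a vertex of the simplex where the average is positive.
  have hpos : ∀ x ∈ K, ∃ w ∈ Set.range fun j : u => (Pi.single j 1 : u → ℝ),
      0 < ∑ j : u, w j * (h j + l j x) := by
    intro x hx
    by_contra! hcon
    refine hu ⟨x, hx, Set.mem_iInter₂.2 fun y hy => ?_⟩
    simpa [Pi.single_apply] using hcon _ ⟨⟨y, hy⟩, rfl⟩
  obtain ⟨w, hw, hwpos⟩ := Sion.exists_lt_iInf_of_lt_iInf_of_finite (X := K)
    (Y := stdSimplex ℝ u) (f := fun x w => ∑ j : u, w j * (h j + l j x)) hKne hKc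
    (fun w _ => (by
      have : Continuous fun x => ∑ j : u, w j * (h j + l j x) :=
        continuous_finsetSum _ fun j _ =>
          continuous_const.mul (continuous_const.add (hl j))
      exact this.continuousOn.lowerSemicontinuousOn))
    (fun w _ => by
      have : (fun x => ∑ j : u, w j * (h j + l j x)) =
          (fun x => (∑ j : u, w j • l j) x + ∑ j : u, w j * h j) := by
        ext x; simp [mul_add, Finset.sum_add_distrib, add_comm, LinearMap.sum_apply]
      rw [this]
      exact (((∑ j : u, w j • l j).convexOn hKconv).add_const _).quasiconvexOn)
    (convex_stdSimplex ℝ u)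
    (fun x _ => (by
      have : Continuous fun w : u → ℝ => ∑ j : u, w j * (h j + l j x) := by fun_prop
      exact this.continuousOn.upperSemicontinuousOn))
    (fun x _ => by
      let L : (u → ℝ) →ₗ[ℝ] ℝ := ∑ j : u, (h j + l j x) • LinearMap.proj j
      have : (fun w : u → ℝ => ∑ j : u, w j * (h j + l j x)) = L := by
        ext w; simp [L, mul_comm, LinearMap.sum_apply]
      rw [this]
      exact (L.concaveOn (convex_stdSimplex ℝ u)).quasiconcaveOn)
    hKconv (Set.finite_range _)
    (by rintro _ ⟨j, rfl⟩; exact single_mem_stdSimplex ℝ j) hpos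
  have hyY : ∑ j : u, w j • ((j : Y) : V) ∈ Y :=
    hh.1.sum_mem (fun j _ => hw.1 j) hw.2 fun j _ => j.1.2
  obtain ⟨x, hx, hxy⟩ := hY _ hyY
  have hconc := hh.le_map_sum (t := Finset.univ) (w := w) (p := fun j : u => ((j : Y) : V))
    (fun j _ => hw.1 j) hw.2 fun j _ => j.1.2
  have := hwpos x hx
  simp only [mul_add, Finset.sum_add_distrib] at this
  simp only [smul_eq_mul, map_sum, map_smul, LinearMap.sum_apply, LinearMap.smul_apply] at hconc hxy
  linarith

end Minimax

/-! ### The set of density matrices -/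

section Density

variable {B : Type*} [Fintype B]

theorem convex_setOf_density :
    Convex ℝ {σ : Matrix B B ℂ | σ.PosSemidef ∧ σ.trace = 1} := by
  rintro σ ⟨hσ, hσ1⟩ τ ⟨hτ, hτ1⟩ a b ha hb hab
  refine ⟨(hσ.smul ha).add (hτ.smul hb), ?_⟩
  rw [trace_add, trace_smul, trace_smul, hσ1, hτ1, ← add_smul, hab, one_smul]

/-- It is the continuous image under D ↦ DᴴD of the Frobenius unit sphere, whose entries have
modulus at most 1. -/
theorem isCompact_setOf_density :
    IsCompact {σ : Matrix B B ℂ | σ.PosSemidef ∧ σ.trace = 1} := by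
  classical
  have htr : ∀ D : Matrix B B ℂ, (Dᴴ * D).trace = ((∑ i, ∑ j, ‖D j i‖ ^ 2 : ℝ) : ℂ) := by
    intro D
    simp [trace, mul_apply, ← Complex.conj_mul']
  have hK : {σ : Matrix B B ℂ | σ.PosSemidef ∧ σ.trace = 1} =
      (fun D : Matrix B B ℂ => Dᴴ * D) '' {D | (Dᴴ * D).trace = 1} := by
    ext σ
    constructor
    · rintro ⟨hσ, hσ1⟩
      open scoped MatrixOrder in
      obtain ⟨D, rfl⟩ := (CStarAlgebra.nonneg_iff_eq_star_mul_self).mp hσ.nonneg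
      exact ⟨D, hσ1, rfl⟩
    · rintro ⟨D, hD, rfl⟩
      exact ⟨posSemidef_conjTranspose_mul_self D, hD⟩
  rw [hK]
  have hcont : Continuous fun D : Matrix B B ℂ => Dᴴ * D := by fun_prop
  refine IsCompact.image ?_ hcont
  have hbox : IsCompact (Set.univ.pi fun _ : B => Set.univ.pi fun _ : B =>
      Metric.closedBall (0 : ℂ) 1) :=
    isCompact_univ_pi fun _ => isCompact_univ_pi fun _ => isCompact_closedBall 0 1
  refine hbox.of_isClosed_subset (isClosed_eq hcont.matrix_trace continuous_const) ?_
  intro D hD i _ j _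
  have h1 : ∑ i, ∑ j, ‖D j i‖ ^ 2 = 1 := by
    have := (htr D).symm.trans hD
    exact_mod_cast this
  have h2 : ‖D i j‖ ^ 2 ≤ 1 := by
    rw [← h1]
    refine le_trans ?_ (Finset.single_le_sum (f := fun i => ∑ j, ‖D j i‖ ^ 2)
      (fun _ _ => by positivity) (Finset.mem_univ j))
    exact Finset.single_le_sum (f := fun i => ‖D i j‖ ^ 2) (fun _ _ => by positivity)
      (Finset.mem_univ i)
  rw [mem_closedBall_zero_iff]
  exact (sq_le_one_iff₀ (norm_nonneg _)).1 h2

/-- The witnesses are the largest eigenvalue of `S` and a corresponding eigenprojection. -/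
theorem exists_density_trace_mul_eq [DecidableEq B] [Nonempty B] {S : Matrix B B ℂ}
    (hS : S.PosDef) : ∃ (σ : DensityMatrix B) (r : ℝ), 0 < r ∧ (trace (σ.mat * S)).re = r ∧
      (r • 1 - S).PosSemidef := by
  obtain ⟨μ, E, hE, hE1, -, hSE, -, hμ⟩ := exists_spectral_povm hS.isHermitian
  obtain ⟨k, hk⟩ := Finite.exists_max μ
  refine ⟨⟨E.effect k, E.posSemidef k, hE1 k⟩, μ k, hμ hS k, ?_, ?_⟩
  · conv_lhs => rw [hSE]
    rw [re_trace_mul_sum_smul]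
    simp [hE, apply_ite, hE1]
  · have : μ k • 1 - S = ∑ j, (μ k - μ j) • E.effect j := by
      conv_lhs => rw [hSE]
      simp only [sub_smul, Finset.sum_sub_distrib, ← Finset.smul_sum, E.sum_eq_one]
    rw [this]
    exact posSemidef_sum _ fun j _ => (E.posSemidef j).smul (sub_nonneg.2 (hk j))

end Density

/-! ### One density matrix for all measurements -/

section Key

variable {X B : Type*} [Fintype X] [Fintype B] [DecidableEq B]

/-- The pairing `(ω, σ) ↦ ∑ x, Re Tr[σ ω x]`. -/
noncomputable def tracePairing (X B : Type*) [Fintype X] [Fintype B] :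
    (X → Matrix B B ℂ) →ₗ[ℝ] Matrix B B ℂ →ₗ[ℝ] ℝ :=
  LinearMap.mk₂ ℝ (fun ω σ => ∑ x, (trace (σ * ω x)).re)
    (fun ω₁ ω₂ σ => by simp [mul_add, Finset.sum_add_distrib])
    (fun c ω σ => by simp [Finset.mul_sum])
    (fun ω σ₁ σ₂ => by simp [add_mul, Finset.sum_add_distrib])
    (fun c ω σ => by simp [Finset.mul_sum])

theorem tracePairing_apply {X B : Type*} [Fintype X] [Fintype B] (ω : X → Matrix B B ℂ)
    (σ : Matrix B B ℂ) : tracePairing X B ω σ = ∑ x, (trace (σ * ω x)).re := rfl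

/-- With r the largest eigenvalue of ∑ ω_x, the family r⁻¹ω is subnormalized; the missing mass is
spread evenly over the outcomes. -/
theorem exists_density_povm_of_posDef [Nonempty X] [Nonempty B] {ω : X → Matrix B B ℂ}
    (hω : ∀ x, (ω x).PosDef) :
    ∃ (σ : DensityMatrix B) (r : ℝ) (M : POVM X B), 0 < r ∧ ∑ x, (trace (σ.mat * ω x)).re = r ∧
      ∀ x, (M.effect x - r⁻¹ • ω x).PosSemidef := by
  obtain ⟨σ, r, hr, hσ, hS⟩ := exists_density_trace_mul_eq
    (posDef_sum Finset.univ_nonempty fun x _ => hω x)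
  have hcompl : ((Fintype.card X : ℝ)⁻¹ • (1 - r⁻¹ • ∑ x, ω x)).PosSemidef := by
    have : (1 : Matrix B B ℂ) - r⁻¹ • ∑ x, ω x = r⁻¹ • (r • 1 - ∑ x, ω x) := by
      rw [smul_sub, smul_smul, inv_mul_cancel₀ hr.ne', one_smul]
    rw [this]
    exact (hS.smul (inv_nonneg.2 hr.le)).smul (by positivity)
  refine ⟨σ, r, ⟨fun x => r⁻¹ • ω x + (Fintype.card X : ℝ)⁻¹ • (1 - r⁻¹ • ∑ x, ω x),
    fun x => ((hω x).posSemidef.smul (inv_nonneg.2 hr.le)).add hcompl, ?_⟩, hr, ?_, fun x => ?_⟩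
  · rw [Finset.sum_add_distrib, ← Finset.smul_sum, Finset.sum_const, Finset.card_univ,
      ← Nat.cast_smul_eq_nsmul ℝ, smul_smul, mul_inv_cancel₀ (by simp), one_smul]
    abel
  · rw [← hσ, Finset.mul_sum, trace_sum, Complex.re_sum]
  · simpa using hcompl

variable [DecidableEq X]

/-- Exchange of quantifiers: in `h` the state may depend on ω, in the conclusion it is universal.
Minimax gives this for operators ω; pinching and Jensen pass to measurements with weights. -/
theorem exists_density_forall_sum_le (ρ : CQState X B) {f : ℝ → ℝ}
    (hf : OperatorJensen (X × B) f) {a b : ℝ}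
    (h : ∀ ω : X → Matrix B B ℂ, (∀ x, (ω x).PosDef) → ∃ σ : DensityMatrix B,
      (trace (ρ.joint * cfc f (cqOperator ω))).re ≤ a + b * ∑ x, (trace (σ.mat * ω x)).re) :
    ∃ σ : DensityMatrix B, ∀ (n : ℕ) (M : POVM (Fin n) (X × B)) (c : Fin n → ℝ), (∀ i, 0 < c i) →
      ∑ i, (trace (ρ.joint * M.effect i)).re * f (c i) ≤
        a + b * ∑ i, (trace ((1 : Matrix X X ℂ) ⊗ₖ σ.mat * M.effect i)).re * c i := by
  have hconc := hf.concaveOn ρ.posSemidef_joint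
  have hYconv : Convex ℝ {ω : X → Matrix B B ℂ | ∀ x, (ω x).PosDef} := by
    -- Only the convexity of the domain is used here.
    have hd := (operatorJensen_log (d := B)).concaveOn PosSemidef.zero |>.1
    exact fun ω hω η hη s t hs ht hst x => hd (hω x) (hη x) hs ht hst
  have hg : ConcaveOn ℝ {ω : X → Matrix B B ℂ | ∀ x, (ω x).PosDef} fun ω =>
      (trace (ρ.joint * cfc f (cqOperator ω))).re + -a := by
    refine ConcaveOn.add_const ⟨hYconv, fun ω hω η hη s t hs ht hst => ?_⟩ _
    have := hconc.2 (posDef_cqOperator hω) (posDef_cqOperator hη) hs ht hst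
    rwa [← cqOperator_smul, ← cqOperator_smul, ← cqOperator_add] at this
  obtain ⟨x₀⟩ := ρ.dist.nonempty
  obtain ⟨σ, hσ, hσY⟩ := exists_forall_add_le_zero (K := {σ : Matrix B B ℂ | σ.PosSemidef ∧ σ.trace = 1})
    ⟨(ρ.cond x₀).mat, (ρ.cond x₀).posSemidef, (ρ.cond x₀).trace_eq_one⟩ isCompact_setOf_density
    convex_setOf_density hg (-b • tracePairing X B)
    (fun ω => by
      simp only [LinearMap.smul_apply]
      have : Continuous fun σ : Matrix B B ℂ => -b * ∑ x, (trace (σ * ω x)).re := by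
        refine continuous_const.mul (continuous_finsetSum _ fun x _ => ?_)
        exact Complex.continuous_re.comp (continuous_id.matrix_mul continuous_const).matrix_trace
      exact this)
    (fun ω hω => by
      obtain ⟨σ, hσ⟩ := h ω hω
      refine ⟨σ.mat, ⟨σ.posSemidef, σ.trace_eq_one⟩, ?_⟩
      simp only [LinearMap.smul_apply, tracePairing_apply, smul_eq_mul]
      linarith)
  refine ⟨⟨σ, hσ.1, hσ.2⟩, fun n M c hc => ?_⟩
  have hωpos : ∀ x, (∑ i, c i • (M.diagBlock x).effect i).PosDef := fun x =>
    (M.diagBlock x).posDef_sum_smul hc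
  have hω : cqOperator (fun x => ∑ i, c i • (M.diagBlock x).effect i) =
      ∑ i, c i • M.pinching.effect i := by
    rw [cqOperator_sum]
    exact Finset.sum_congr rfl fun i _ => cqOperator_smul (c i) fun x => (M.diagBlock x).effect i
  have h1 := hf.sum_le M.pinching hc (posDef_cqOperator hωpos).posSemidef
    (by rw [hω, sub_self]; exact PosSemidef.zero) ρ.posSemidef_joint
  have h2 := hσY _ hωpos
  simp only [LinearMap.smul_apply, tracePairing_apply, smul_eq_mul] at h2
  have h3 : ∑ i, (trace ((1 : Matrix X X ℂ) ⊗ₖ σ * M.effect i)).re * c i =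
      ∑ x, (trace (σ * ∑ i, c i • (M.diagBlock x).effect i)).re := by
    simp only [re_trace_mul_sum_smul]
    rw [Finset.sum_comm]
    refine Finset.sum_congr rfl fun i _ => ?_
    rw [← cqOperator_const, trace_cqOperator_mul, Complex.re_sum, Finset.sum_mul]
    rfl
  simp only [CQState.joint, trace_cqOperator_mul_pinching] at h1
  simp only [h3, CQState.joint] at h2 ⊢
  linarith

/-- Measuring in an eigenbasis of `Π_XB` expresses every `Tr[ρ_XB f(Π_XB)]` through the outcome
distribution. -/
theorem POVM.exists_eigen_measurement (ρ : CQState X B) (M : POVM X B) :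
    ∃ (n : ℕ) (E : POVM (Fin n) (X × B)) (μ : Fin n → ℝ), (∀ i, 0 ≤ μ i) ∧
      (∀ f : ℝ → ℝ, (trace (ρ.joint * cfc f M.joint)).re =
        ∑ i, (trace (ρ.joint * E.effect i)).re * f (μ i)) ∧
      (∀ σ : DensityMatrix B,
        ∑ i, (trace ((1 : Matrix X X ℂ) ⊗ₖ σ.mat * E.effect i)).re * μ i = 1) ∧
      (∑ i, (trace (ρ.joint * E.effect i)).re * μ i ≤ 1) ∧
      (SuppLE ρ.joint M.joint → ∀ i, μ i = 0 → (trace (ρ.joint * E.effect i)).re = 0) := by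
  obtain ⟨μ, E, hE, -, hf, hM, hμ, -⟩ := exists_spectral_povm M.posSemidef_joint.isHermitian
  let e := (Fintype.equivFin (X × B)).symm
  have hsum : ∀ A : Matrix (X × B) (X × B) ℂ,
      ∑ i, (trace (A * (E.reindex e).effect i)).re * μ (e i) = (trace (A * M.joint)).re := by
    intro A
    conv_rhs => rw [hM]
    rw [re_trace_mul_sum_smul, ← e.sum_comp]
    rfl
  refine ⟨_, E.reindex e, μ ∘ e, fun i => hμ M.posSemidef_joint _, fun f => ?_, fun σ => ?_, ?_,
    fun hsupp i hi => ?_⟩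
  · rw [hf, re_trace_mul_sum_smul, ← e.sum_comp]
    rfl
  · refine (hsum _).trans ?_
    rw [← cqOperator_const, trace_cqOperator_mul]
    simp only [POVM.joint, diagBlock_cqOperator]
    rw [← trace_sum, ← Finset.mul_sum, M.sum_eq_one, mul_one, σ.trace_eq_one, Complex.one_re]
  · refine (hsum _).trans_le ?_
    have h1 : (1 - M.joint).PosSemidef := by
      rw [← cqOperator_one (X := X) (B := B), POVM.joint, ← cqOperator_sub]
      refine posSemidef_cqOperator fun x => ?_
      rw [Pi.sub_apply, ← M.sum_eq_one, ← Finset.sum_erase_eq_sub (Finset.mem_univ x)]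
      exact posSemidef_sum _ fun y _ => M.posSemidef y
    have := re_trace_mul_nonneg ρ.posSemidef_joint h1
    rw [mul_sub, mul_one, trace_sub, ρ.trace_joint] at this
    simpa using this
  -- The columns of an eigenprojection at eigenvalue zero lie in the kernel of `M.joint`, hence in
  -- that of `ρ.joint`.
  · have h0 : M.joint * E.effect (e i) = 0 := by
      rw [hM, Finset.sum_mul]
      refine Finset.sum_eq_zero fun k _ => ?_
      rw [smul_mul_assoc, hE]
      split_ifs with hk
      · subst hk; rw [show μ (e i) = 0 from hi, zero_smul]
      · simp
    have h1 : ρ.joint * E.effect (e i) = 0 := by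
      ext j k
      have := hsupp ((E.effect (e i)).col k) (by
        ext l; exact congrFun (congrFun h0 l) k)
      exact congrFun this j
    change (trace (ρ.joint * E.effect (e i))).re = 0
    rw [h1]; simp

/-- Guessing with a measurement that dominates a rescaled positive definite operator. -/
theorem exists_density_povm_spectrum (ρ : CQState X B) {ω : X → Matrix B B ℂ}
    (hω : ∀ x, (ω x).PosDef) :
    ∃ (σ : DensityMatrix B) (r : ℝ) (M : POVM X B) (u v : X × B → ℝ), 0 < r ∧
      ∑ x, (trace (σ.mat * ω x)).re = r ∧ M.joint.PosDef ∧ ∑ k, u k = 1 ∧ (∀ k, 0 < v k) ∧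
      ∀ f : ℝ → ℝ, (trace (ρ.joint * cfc f (cqOperator ω))).re = ∑ k, u k * f (v k) ∧
        (OperatorJensen (X × B) f →
          ∑ k, u k * f (r⁻¹ * v k) ≤ (trace (ρ.joint * cfc f M.joint)).re) := by
  have hX := ρ.dist.nonempty
  have hB := (ρ.cond hX.some).nonempty
  obtain ⟨σ, r, M, hr, hσ, hM⟩ := exists_density_povm_of_posDef hω
  obtain ⟨μ, E, -, -, hf, hωE, -, hμ⟩ :=
    exists_spectral_povm (posDef_cqOperator hω).isHermitian
  have hμ := hμ (posDef_cqOperator hω)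
  have hMω : (M.joint - ∑ k, (r⁻¹ * μ k) • E.effect k).PosSemidef := by
    simp only [mul_smul]
    rw [← Finset.smul_sum, ← hωE, POVM.joint, ← cqOperator_smul, ← cqOperator_sub]
    exact posSemidef_cqOperator hM
  have hpos : ∀ k, 0 < r⁻¹ * μ k := fun k => mul_pos (inv_pos.2 hr) (hμ k)
  refine ⟨σ, r, M, fun k => (trace (ρ.joint * E.effect k)).re, μ, hr, hσ, ?_, ?_, hμ, fun f =>
    ⟨?_, fun hfJ => ?_⟩⟩
  · simpa using PosDef.posSemidef_add hMω (E.posDef_sum_smul hpos)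
  · rw [E.sum_re_trace, ρ.trace_joint, Complex.one_re]
  · rw [hf, re_trace_mul_sum_smul]
  · exact hfJ.sum_le E hpos M.posSemidef_joint hMω ρ.posSemidef_joint

end Key

/-! ### Variational bounds for classical Rényi divergences -/

section Classical

variable {ι : Type*} [Fintype ι]

theorem gainExponent_pos {α : ℝ≥0∞} (hα : 1 < α) : 0 < gainExponent α := by
  rw [gainExponent]
  split_ifs with h
  · exact one_pos
  · have : 1 < α.toReal := by simpa using (ENNReal.toReal_lt_toReal ENNReal.one_ne_top h).2 hα
    exact div_pos (by linarith) (by linarith)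

theorem gainExponent_le_one {α : ℝ≥0∞} (hα : 1 < α) : gainExponent α ≤ 1 := by
  rw [gainExponent]
  split_ifs with h
  · exact le_rfl
  · have : 1 < α.toReal := by simpa using (ENNReal.toReal_lt_toReal ENNReal.one_ne_top h).2 hα
    rw [div_le_one (by linarith)]; linarith

open Filter in
/-- If a linear functional of `f ∘ c` is bounded by a linear functional of `c`, then the former is
supported in the support of the latter. -/
theorem eq_zero_of_forall_sum_le {P Q : ι → ℝ} (hP : ∀ i, 0 ≤ P i) {f : ℝ → ℝ}
    (hf : Tendsto f atTop atTop) {a b : ℝ}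
    (h : ∀ c : ι → ℝ, (∀ i, 0 < c i) → ∑ i, P i * f (c i) ≤ a + b * ∑ i, Q i * c i)
    (i : ι) (hQ : Q i = 0) : P i = 0 := by
  classical
  by_contra hPi
  have hPi : 0 < P i := lt_of_le_of_ne (hP i) (Ne.symm hPi)
  set R := ∑ j ∈ Finset.univ.erase i, P j * f 1
  set T := ∑ j ∈ Finset.univ.erase i, Q j
  -- Give `i` weight `t` and all other points weight 1: as `Q i = 0`, the right side does not depend
  -- on `t`, whereas `P i * f t` is unbounded.
  obtain ⟨t, ht, ht0⟩ := ((hf.const_mul_atTop hPi).eventually_gt_atTop (a + b * T - R)).and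
    (eventually_gt_atTop 0) |>.exists
  have := h (Function.update 1 i t) (fun j => by
    by_cases hj : j = i
    · subst hj; simpa
    · simp [hj])
  rw [← Finset.add_sum_erase _ _ (Finset.mem_univ i),
    ← Finset.add_sum_erase _ _ (Finset.mem_univ i)] at this
  have hR : ∑ j ∈ Finset.univ.erase i, P j * f (Function.update (1 : ι → ℝ) i t j) = R :=
    Finset.sum_congr rfl fun j hj => by simp [Finset.ne_of_mem_erase hj]
  have hT : ∑ j ∈ Finset.univ.erase i, Q j * Function.update (1 : ι → ℝ) i t j = T :=
    Finset.sum_congr rfl fun j hj => by simp [Finset.ne_of_mem_erase hj]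
  rw [hR, hT] at this
  simp only [Function.update_self, hQ, zero_mul, zero_add] at this
  linarith

/-- The optimal weights are c = P/Q. Weights must be positive, so δ replaces them where P vanishes,
at a cost of at most ε. -/
theorem renyiDiv_one_le {P Q : ι → ℝ} (hP : ∀ i, 0 ≤ P i) (hQ : ∀ i, 0 ≤ Q i) (hP1 : ∑ i, P i = 1)
    {a : ℝ} (h : ∀ c : ι → ℝ, (∀ i, 0 < c i) →
      ∑ i, P i * Real.log (c i) ≤ a - 1 + 1 * ∑ i, Q i * c i) :
    renyiDiv 1 P Q ≤ (a : EReal) := by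
  have hsupp := eq_zero_of_forall_sum_le hP Real.tendsto_log_atTop h
  rw [renyiDiv, if_pos hsupp, if_pos rfl, EReal.coe_le_coe_iff]
  refine le_of_forall_pos_le_add fun ε hε => ?_
  have hQs : 0 ≤ ∑ i, Q i := Finset.sum_nonneg fun i _ => hQ i
  set δ := ε / (∑ i, Q i + 1)
  have hδ : 0 < δ := by positivity
  have hδQ : δ * ∑ i, Q i ≤ ε := by
    rw [div_mul_eq_mul_div, div_le_iff₀ (by positivity)]; nlinarith
  have hQpos : ∀ i, P i ≠ 0 → 0 < Q i := fun i hi => lt_of_le_of_ne (hQ i) fun h0 =>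
    hi (hsupp i h0.symm)
  have key := h (fun i => if P i = 0 then δ else P i / Q i) fun i => by
    split_ifs with hi
    · exact hδ
    · exact div_pos (lt_of_le_of_ne (hP i) (Ne.symm hi)) (hQpos i hi)
  have h1 : ∑ i, P i * Real.log (if P i = 0 then δ else P i / Q i) =
      ∑ i, P i * Real.log (P i / Q i) := Finset.sum_congr rfl fun i _ => by
    split_ifs with hi
    · simp [hi]
    · rfl
  have h2 : ∑ i, Q i * (if P i = 0 then δ else P i / Q i) ≤ 1 + δ * ∑ i, Q i := by
    rw [← hP1, Finset.mul_sum, ← Finset.sum_add_distrib]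
    refine Finset.sum_le_sum fun i _ => ?_
    split_ifs with hi
    · rw [hi]; linarith
    · rw [mul_div_cancel₀ _ (hQpos i hi).ne']
      have := mul_nonneg hδ.le (hQ i); linarith
  rw [h1] at key
  linarith

-- For finite α = a the optimal weights are (P/Q)^a / S, normalized so that ∑ Q c = 1; the right
-- side is then G and the left side S^(1/a). At α = ∞ indicator weights give P ≤ G Q.
open Filter Topology in
theorem renyiDiv_le_of_forall_sum_rpow_le {α : ℝ≥0∞} (hα : 1 < α) {P Q : ι → ℝ}
    (hP : ∀ i, 0 ≤ P i) (hQ : ∀ i, 0 ≤ Q i) (hP1 : ∑ i, P i = 1) {G : ℝ} (hG : 0 < G)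
    (h : ∀ c : ι → ℝ, (∀ i, 0 < c i) → ∑ i, P i * c i ^ gainExponent α ≤
      G * (1 - gainExponent α) + G * gainExponent α * ∑ i, Q i * c i) :
    renyiDiv α P Q ≤ (((gainExponent α)⁻¹ * Real.log G : ℝ) : EReal) := by
  have hβ := gainExponent_pos hα
  have hsupp := eq_zero_of_forall_sum_le hP (tendsto_rpow_atTop hβ) h
  -- The optimal weights may vanish, so the hypothesis is extended to the boundary by continuity.
  have h' : ∀ c : ι → ℝ, (∀ i, 0 ≤ c i) → ∑ i, P i * c i ^ gainExponent α ≤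
      G * (1 - gainExponent α) + G * gainExponent α * ∑ i, Q i * c i := by
    intro c hc
    have hcont1 : Continuous fun δ : ℝ => ∑ i, P i * (c i + δ) ^ gainExponent α :=
      continuous_finsetSum _ fun i _ => continuous_const.mul
        ((Real.continuous_rpow_const hβ.le).comp (continuous_const.add continuous_id))
    have hcont2 : Continuous fun δ : ℝ =>
      G * (1 - gainExponent α) + G * gainExponent α * ∑ i, Q i * (c i + δ) := by fun_prop
    have := le_of_tendsto_of_tendsto (b := 𝓝[>] (0 : ℝ)) (hcont1.tendsto 0 |>.mono_left inf_le_left)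
      (hcont2.tendsto 0 |>.mono_left inf_le_left) (by
        filter_upwards [self_mem_nhdsWithin] with δ hδ
        exact h _ fun i => add_pos_of_nonneg_of_pos (hc i) hδ)
    simpa using this
  have hQpos : ∀ i, P i ≠ 0 → 0 < Q i := fun i hi => lt_of_le_of_ne (hQ i) fun h0 =>
    hi (hsupp i h0.symm)
  obtain ⟨j, hj⟩ : ∃ j, P j ≠ 0 := by
    by_contra! hcon
    simp [hcon] at hP1
  have hPj : 0 < P j := lt_of_le_of_ne (hP j) (Ne.symm hj)
  rw [renyiDiv, if_pos hsupp, if_neg hα.ne']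
  by_cases htop : α = ∞
  · have hβ1 : gainExponent α = 1 := if_pos htop
    rw [if_pos htop, EReal.coe_le_coe_iff]
    simp only [hβ1, Real.rpow_one, sub_self, mul_zero, zero_add, mul_one, inv_one, one_mul] at h' ⊢
    have hle : ∀ i, P i / Q i ≤ G := by
      classical
      intro i
      by_cases hi : P i = 0
      · simp [hi, hG.le]
      · rw [div_le_iff₀ (hQpos i hi)]
        simpa [Pi.single_apply] using h' (Pi.single i 1) fun j => by
          rw [Pi.single_apply]; split_ifs <;> norm_num
    have : Nonempty ι := ⟨j⟩
    refine Real.log_le_log ?_ (ciSup_le hle)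
    exact (div_pos hPj (hQpos j hj)).trans_le (le_ciSup ⟨G, by rintro _ ⟨i, rfl⟩; exact hle i⟩ j)
  · rw [if_neg htop, EReal.coe_le_coe_iff]
    have hβdef : gainExponent α = (α.toReal - 1) / α.toReal := if_neg htop
    have ha : 1 < α.toReal := by
      simpa using (ENNReal.toReal_lt_toReal ENNReal.one_ne_top htop).2 hα
    set a := α.toReal
    set S := ∑ i, P i ^ a * Q i ^ (1 - a)
    have hS : 0 < S := (mul_pos (Real.rpow_pos_of_pos hPj _)
      (Real.rpow_pos_of_pos (hQpos j hj) _)).trans_le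
        (Finset.single_le_sum (f := fun i => P i ^ a * Q i ^ (1 - a))
          (fun i _ => mul_nonneg (Real.rpow_nonneg (hP i) _) (Real.rpow_nonneg (hQ i) _))
          (Finset.mem_univ j))
    have key := h' (fun i => (P i / Q i) ^ a / S) fun i =>
      div_nonneg (Real.rpow_nonneg (div_nonneg (hP i) (hQ i)) _) hS.le
    have h1 : ∑ i, Q i * ((P i / Q i) ^ a / S) = 1 := by
      rw [← div_self hS.ne', Finset.sum_div]
      refine Finset.sum_congr rfl fun i _ => ?_
      by_cases hi : P i = 0
      · simp [hi, Real.zero_rpow (show a ≠ 0 by linarith)]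
      · rw [Real.div_rpow (hP i) (hQ i), Real.rpow_sub (hQpos i hi), Real.rpow_one]
        ring
    have h2 : ∑ i, P i * ((P i / Q i) ^ a / S) ^ gainExponent α = S ^ (1 / a) := by
      have : S ^ (1 / a) = S / S ^ gainExponent α := by
        rw [hβdef, ← Real.rpow_one_sub' hS.le]
        · congr 1; field_simp; ring
        · have : 1 - (a - 1) / a = 1 / a := by field_simp; ring
          rw [this]; positivity
      rw [this, Finset.sum_div]
      refine Finset.sum_congr rfl fun i _ => ?_
      by_cases hi : P i = 0
      · simp [hi, Real.zero_rpow (show a ≠ 0 by linarith)]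
      · have hPi : 0 < P i := lt_of_le_of_ne (hP i) (Ne.symm hi)
        have hQi := hQpos i hi
        have hab : a * gainExponent α = a - 1 := by rw [hβdef]; field_simp
        rw [Real.div_rpow (Real.rpow_nonneg (div_nonneg (hP i) (hQ i)) _) hS.le,
          ← Real.rpow_mul (div_nonneg (hP i) (hQ i)), hab, Real.div_rpow (hP i) (hQ i),
          Real.rpow_sub hPi, Real.rpow_one, show 1 - a = -(a - 1) by ring, Real.rpow_neg (hQ i)]
        field_simp
    rw [h1, h2] at key
    have hSG : S ^ (1 / a) ≤ G := by linarith
    have hlog := Real.log_le_log (Real.rpow_pos_of_pos hS _) hSG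
    rw [Real.log_rpow hS] at hlog
    rw [hβdef, inv_div]
    have ha1 : 0 < a - 1 := by linarith
    calc 1 / (a - 1) * Real.log S = a / (a - 1) * (1 / a * Real.log S) := by field_simp
      _ ≤ _ := by gcongr

/-- Gibbs' inequality: apply log x ≤ x - 1 at x = Q v / P and average over P. -/
theorem sum_mul_log_le_renyiDiv_one {P Q v : ι → ℝ} (hP : ∀ i, 0 ≤ P i) (hQ : ∀ i, 0 ≤ Q i)
    (hv : ∀ i, 0 ≤ v i) (hP1 : ∑ i, P i = 1) (hQv : ∑ i, Q i * v i = 1)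
    (hPv : ∀ i, v i = 0 → P i = 0) :
    ((∑ i, P i * Real.log (v i) : ℝ) : EReal) ≤ renyiDiv 1 P Q := by
  rw [renyiDiv, if_pos rfl]
  split_ifs with hsupp
  · rw [EReal.coe_le_coe_iff]
    have : ∑ i, P i * Real.log (v i) ≤ ∑ i, (P i * Real.log (P i / Q i) + (Q i * v i - P i)) := by
      refine Finset.sum_le_sum fun i _ => ?_
      by_cases hi : P i = 0
      · simpa [hi] using mul_nonneg (hQ i) (hv i)
      · have hPi : 0 < P i := lt_of_le_of_ne (hP i) (Ne.symm hi)
        have hQi : 0 < Q i := lt_of_le_of_ne (hQ i) fun h0 => hi (hsupp i h0.symm)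
        have hvi : 0 < v i := lt_of_le_of_ne (hv i) fun h0 => hi (hPv i h0.symm)
        have h1 : Real.log (v i) - Real.log (P i / Q i) ≤ Q i * v i / P i - 1 := by
          rw [← Real.log_div hvi.ne' (div_pos hPi hQi).ne']
          refine (Real.log_le_sub_one_of_pos (by positivity)).trans_eq ?_
          field_simp
        have h2 := mul_le_mul_of_nonneg_left h1 hPi.le
        have h3 : P i * (Q i * v i / P i - 1) = Q i * v i - P i := by field_simp
        linarith
    rw [Finset.sum_add_distrib, Finset.sum_sub_distrib, hP1, hQv] at this
    linarith
  · exact le_top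

theorem sum_mul_rpow_le_exp {α : ℝ≥0∞} (hα : 1 < α) {P Q v : ι → ℝ} (hP : ∀ i, 0 ≤ P i)
    (hQ : ∀ i, 0 ≤ Q i) (hv : ∀ i, 0 ≤ v i) (hQv : ∑ i, Q i * v i = 1) {r : ℝ}
    (h : renyiDiv α P Q ≤ (r : EReal)) :
    ∑ i, P i * v i ^ gainExponent α ≤ Real.exp (gainExponent α * r) := by
  rw [renyiDiv] at h
  split_ifs at h with hsupp h1 htop
  · exact absurd h1 hα.ne'
  · have hβ1 : gainExponent α = 1 := if_pos htop
    simp only [hβ1, Real.rpow_one, one_mul]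
    rw [EReal.coe_le_coe_iff] at h
    have hS : (⨆ i, P i / Q i) ≤ Real.exp r := by
      obtain hS | hS := le_or_gt (⨆ i, P i / Q i) 0
      · exact hS.trans (Real.exp_pos r).le
      · rwa [← Real.log_le_iff_le_exp hS]
    calc ∑ i, P i * v i ≤ ∑ i, Real.exp r * (Q i * v i) := by
          refine Finset.sum_le_sum fun i _ => ?_
          rw [← mul_assoc]
          refine mul_le_mul_of_nonneg_right ?_ (hv i)
          by_cases hi : Q i = 0
          · simp [hi, hsupp i hi]
          · rw [← div_le_iff₀ (lt_of_le_of_ne (hQ i) (Ne.symm hi))]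
            exact (le_ciSup (Set.finite_range fun i => P i / Q i).bddAbove i).trans hS
      _ = Real.exp r := by rw [← Finset.mul_sum, hQv, mul_one]
  · rw [EReal.coe_le_coe_iff] at h
    have hβdef : gainExponent α = (α.toReal - 1) / α.toReal := if_neg htop
    have ha : 1 < α.toReal := by
      simpa using (ENNReal.toReal_lt_toReal ENNReal.one_ne_top htop).2 hα
    set a := α.toReal
    set S := ∑ i, P i ^ a * Q i ^ (1 - a)
    have hβ := gainExponent_pos hα
    set β := gainExponent α
    have ha1 : 0 < a - 1 := by linarith
    have hab : a * β = a - 1 := by rw [hβdef]; field_simp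
    have hconj : a.HolderConjugate β⁻¹ := by
      rw [Real.holderConjugate_iff, inv_inv, hβdef]
      exact ⟨ha, by field_simp; ring⟩
    have hS0 : 0 ≤ S := Finset.sum_nonneg fun i _ =>
      mul_nonneg (Real.rpow_nonneg (hP i) _) (Real.rpow_nonneg (hQ i) _)
    -- Hölder for P v^β = (P Q^(-β)) · (Q v)^β with exponents a and 1/β; the second factor has norm
    -- one by `hQv`.
    have hhol := Real.inner_le_Lp_mul_Lq_of_nonneg Finset.univ hconj
      (f := fun i => P i * Q i ^ (-β)) (g := fun i => (Q i * v i) ^ β)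
      (fun i _ => mul_nonneg (hP i) (Real.rpow_nonneg (hQ i) _))
      (fun i _ => Real.rpow_nonneg (mul_nonneg (hQ i) (hv i)) _)
    have e1 : ∀ i, P i * Q i ^ (-β) * (Q i * v i) ^ β = P i * v i ^ β := by
      intro i
      by_cases hi : Q i = 0
      · simp [hsupp i hi]
      · have hQi : 0 < Q i := lt_of_le_of_ne (hQ i) (Ne.symm hi)
        rw [Real.mul_rpow (hQ i) (hv i), Real.rpow_neg (hQ i)]
        have := (Real.rpow_pos_of_pos hQi β).ne'
        field_simp
    have e2 : ∀ i, (P i * Q i ^ (-β)) ^ a = P i ^ a * Q i ^ (1 - a) := by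
      intro i
      rw [Real.mul_rpow (hP i) (Real.rpow_nonneg (hQ i) _), ← Real.rpow_mul (hQ i)]
      congr 2; linarith
    have e3 : ∀ i, ((Q i * v i) ^ β) ^ β⁻¹ = Q i * v i := fun i =>
      Real.rpow_rpow_inv (mul_nonneg (hQ i) (hv i)) hβ.ne'
    simp only [e1, e2, e3, hQv, Real.one_rpow, mul_one] at hhol
    refine hhol.trans ?_
    have hSle : S ≤ Real.exp ((a - 1) * r) := by
      obtain hS | hS := hS0.eq_or_lt
      · rw [← hS]; exact (Real.exp_pos _).le
      · rw [← Real.log_le_iff_le_exp hS]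
        rw [one_div, inv_mul_le_iff₀ ha1] at h
        exact h
    calc S ^ (1 / a) ≤ Real.exp ((a - 1) * r) ^ (1 / a) :=
          Real.rpow_le_rpow hS0 hSle (by positivity)
      _ = Real.exp (β * r) := by
          rw [← Real.exp_mul, hβdef]; congr 1; ring
  · simp at h

end Classical

/-! ### Guessing without side information -/

section Prior

variable {X : Type*} [Fintype X]

theorem renyiDiv_const_one {α : ℝ≥0∞} (hα : 1 ≤ α) (p : ProbDist X) :
    renyiDiv α p.prob (fun _ => 1) = ((-renyiEntropy α p : ℝ) : EReal) := by
  rw [renyiDiv, if_pos (by simp), renyiEntropy]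
  split_ifs with h1 htop
  · simp
  · simp
  · have ha : 1 < α.toReal := by
      simpa using (ENNReal.toReal_lt_toReal ENNReal.one_ne_top htop).2 (lt_of_le_of_ne hα (Ne.symm h1))
    have : 1 / (1 - α.toReal) = -(1 / (α.toReal - 1)) := by
      rw [← neg_sub, one_div, one_div, inv_neg]
    simp [this]

/-- Apply both classical bounds with Q = 1. Weights c of total mass s are compared with the guess
c/s, and Bernoulli's inequality linearizes s^β. -/
theorem log_priorMaxExpectedGain {α : ℝ≥0∞} (hα : 1 < α) (p : ProbDist X) :
    0 < priorMaxExpectedGain α p ∧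
    (gainExponent α)⁻¹ * Real.log (priorMaxExpectedGain α p) = -renyiEntropy α p := by
  have hβ := gainExponent_pos hα
  have hX := p.nonempty
  have hle : ∀ q : ProbDist X, ∑ x, p.prob x * q.prob x ^ gainExponent α ≤
      Real.exp (gainExponent α * -renyiEntropy α p) := fun q =>
    sum_mul_rpow_le_exp hα p.nonneg (fun _ => zero_le_one) q.nonneg (by simp [q.sum_eq_one])
      (renyiDiv_const_one hα.le p).le
  have hbdd : BddAbove (Set.range fun q : ProbDist X =>
      ∑ x, p.prob x * q.prob x ^ gainExponent α) := ⟨_, by rintro _ ⟨q, rfl⟩; exact hle q⟩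
  have hpos : 0 < priorMaxExpectedGain α p := by
    refine lt_of_lt_of_le ?_ (le_ciSup hbdd
      ⟨fun _ => (Fintype.card X : ℝ)⁻¹, fun _ => by positivity, by simp⟩)
    simp only [← Finset.sum_mul, p.sum_eq_one, one_mul]
    positivity
  refine ⟨hpos, le_antisymm ?_ ?_⟩
  · have : Nonempty (ProbDist X) := ⟨p⟩
    rw [inv_mul_le_iff₀ hβ, Real.log_le_iff_le_exp hpos]
    exact ciSup_le hle
  · have hG := renyiDiv_le_of_forall_sum_rpow_le hα (Q := fun _ => 1) p.nonneg
      (fun _ => zero_le_one) p.sum_eq_one hpos fun c hc => ?_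
    · rwa [renyiDiv_const_one hα.le, EReal.coe_le_coe_iff] at hG
    · have hs : 0 < ∑ x, c x := Finset.sum_pos (fun x _ => hc x) Finset.univ_nonempty
      set s := ∑ x, c x
      have hq := le_ciSup hbdd ⟨fun x => c x / s, fun x => (div_pos (hc x) hs).le, by
        rw [← Finset.sum_div, div_self hs.ne']⟩
      change _ ≤ priorMaxExpectedGain α p at hq
      simp only [Real.div_rpow (hc _).le hs.le, ← mul_div_assoc, ← Finset.sum_div] at hq
      rw [div_le_iff₀ (Real.rpow_pos_of_pos hs _)] at hq
      refine hq.trans ?_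
      have := rpow_one_add_le_one_add_mul_self (s := s - 1) (by linarith) hβ.le
        (gainExponent_le_one hα)
      rw [add_sub_cancel] at this
      simp only [one_mul]
      calc _ ≤ priorMaxExpectedGain α p * (1 + gainExponent α * (s - 1)) := by gcongr
        _ = _ := by ring

theorem priorMinExpectedLogLoss_eq (p : ProbDist X) :
    priorMinExpectedLogLoss p = (renyiEntropy 1 p : EReal) := by
  refine le_antisymm ((iInf_le _ p).trans ?_) (le_iInf fun q => ?_)
  · rw [priorExpectedLogLoss, if_pos fun _ => id, renyiEntropy, if_pos rfl]
  · rw [priorExpectedLogLoss]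
    split_ifs with hq
    · have := sum_mul_log_le_renyiDiv_one (Q := fun _ => 1) p.nonneg (fun _ => zero_le_one)
        q.nonneg p.sum_eq_one (by simp [q.sum_eq_one]) hq
      rw [renyiDiv_const_one le_rfl, EReal.coe_le_coe_iff] at this
      rw [EReal.coe_le_coe_iff]
      linarith
    · exact le_top

end Prior

/-! ### Gains, log-loss and the measured conditional entropy -/

section Main

variable {X B : Type*} [Fintype X] [DecidableEq X] [Fintype B] [DecidableEq B]

theorem CQState.re_trace_joint_mul_nonneg (ρ : CQState X B) {n : ℕ} (M : POVM (Fin n) (X × B))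
    (i : Fin n) : 0 ≤ (trace (ρ.joint * M.effect i)).re :=
  re_trace_mul_nonneg ρ.posSemidef_joint (M.posSemidef i)

theorem CQState.sum_re_trace_joint_mul (ρ : CQState X B) {n : ℕ} (M : POVM (Fin n) (X × B)) :
    ∑ i, (trace (ρ.joint * M.effect i)).re = 1 := by
  rw [M.sum_re_trace, ρ.trace_joint, Complex.one_re]

theorem DensityMatrix.re_trace_one_kronecker_mul_nonneg (σ : DensityMatrix B) {n : ℕ}
    (M : POVM (Fin n) (X × B)) (i : Fin n) :
    0 ≤ (trace ((1 : Matrix X X ℂ) ⊗ₖ σ.mat * M.effect i)).re :=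
  re_trace_mul_nonneg (PosSemidef.one.kronecker σ.posSemidef) (M.posSemidef i)

/-- The uniform guess. -/
noncomputable def POVM.uniform (X B : Type*) [Fintype X] [Nonempty X] [Fintype B] [DecidableEq B] :
    POVM X B where
  effect _ := (Fintype.card X : ℝ)⁻¹ • 1
  posSemidef _ := PosSemidef.one.smul (by positivity)
  sum_eq_one := by
    rw [Finset.sum_const, Finset.card_univ, ← Nat.cast_smul_eq_nsmul ℝ, smul_smul,
      mul_inv_cancel₀ (by simp), one_smul]

theorem bddAbove_expectedGain {α : ℝ≥0∞} (hα : 1 < α) (ρ : CQState X B) :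
    BddAbove (Set.range fun M : POVM X B => expectedGain α ρ M) := by
  -- The bound 2 comes from t^β ≤ 1 + t, total mass 1, and ∑ P_i μ_i ≤ 1.
  refine ⟨2, ?_⟩
  rintro _ ⟨M, rfl⟩
  obtain ⟨n, E, μ, hμ, hf, -, hle, -⟩ := M.exists_eigen_measurement ρ
  simp only [expectedGain, hf]
  have hβ := gainExponent_pos hα
  have : ∀ i, (trace (ρ.joint * E.effect i)).re * μ i ^ gainExponent α ≤
      (trace (ρ.joint * E.effect i)).re * (1 + μ i) := fun i => by
    refine mul_le_mul_of_nonneg_left ?_ (ρ.re_trace_joint_mul_nonneg E i)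
    calc μ i ^ gainExponent α ≤ (1 + μ i) ^ gainExponent α :=
          Real.rpow_le_rpow (hμ i) (by linarith) hβ.le
      _ ≤ (1 + μ i) ^ (1 : ℝ) :=
          Real.rpow_le_rpow_of_exponent_le (by linarith [hμ i]) (gainExponent_le_one hα)
      _ = _ := Real.rpow_one _
  refine (Finset.sum_le_sum fun i _ => this i).trans ?_
  simp only [mul_add, mul_one, Finset.sum_add_distrib, ρ.sum_re_trace_joint_mul]
  linarith

/-- The uniform guess already gains at least |X|^(-β), by Jensen for the one-outcome measurement. -/
theorem maxExpectedGain_pos {α : ℝ≥0∞} (hα : 1 < α) (ρ : CQState X B) :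
    0 < maxExpectedGain α ρ := by
  have hX := ρ.dist.nonempty
  refine lt_of_lt_of_le ?_ (le_ciSup (bddAbove_expectedGain hα ρ) (POVM.uniform X B))
  let N : POVM (Fin 1) (X × B) := ⟨fun _ => 1, fun _ => PosSemidef.one, by simp⟩
  have hc : (0 : ℝ) < (Fintype.card X : ℝ)⁻¹ := by positivity
  have hj : (POVM.uniform X B).joint = (Fintype.card X : ℝ)⁻¹ • 1 := by
    rw [← cqOperator_one, ← cqOperator_smul]; rfl
  have := operatorJensen_rpow (d := X × B) (gainExponent_pos hα) (gainExponent_le_one hα) 1 N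
    (fun _ => (Fintype.card X : ℝ)⁻¹) (fun _ => hc) (POVM.uniform X B).joint
    (POVM.uniform X B).posSemidef_joint (by simp [hj, N, PosSemidef.zero]) ρ.joint
    ρ.posSemidef_joint
  refine lt_of_lt_of_le ?_ this
  simp only [Finset.univ_unique, Finset.sum_singleton, N, mul_one, ρ.trace_joint, Complex.one_re,
    one_mul]
  positivity

theorem iInf_measuredRenyiDiv {α : ℝ≥0∞} (hα : 1 < α) (ρ : CQState X B) :
    ⨅ σ : DensityMatrix B, measuredRenyiDiv α ρ.joint ((1 : Matrix X X ℂ) ⊗ₖ σ.mat) =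
      (((gainExponent α)⁻¹ * Real.log (maxExpectedGain α ρ) : ℝ) : EReal) := by
  have hβ := gainExponent_pos hα
  have hpos := maxExpectedGain_pos hα ρ
  have hX := ρ.dist.nonempty
  refine le_antisymm ?_ (le_iInf fun σ => ?_)
  · obtain ⟨σ, hσ⟩ := exists_density_forall_sum_le ρ (f := fun t => t ^ gainExponent α)
      (a := maxExpectedGain α ρ * (1 - gainExponent α)) (b := maxExpectedGain α ρ * gainExponent α)
      (operatorJensen_rpow hβ (gainExponent_le_one hα)) fun ω hω => by
        obtain ⟨σ, r, M, u, v, hr, hσ, -, -, hv, hf⟩ := exists_density_povm_spectrum ρ hω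
        refine ⟨σ, ?_⟩
        obtain ⟨hω', hM⟩ := hf fun t => t ^ gainExponent α
        have hM := (hM (operatorJensen_rpow hβ (gainExponent_le_one hα))).trans
          (le_ciSup (bddAbove_expectedGain hα ρ) M)
        change _ ≤ maxExpectedGain α ρ at hM
        rw [hω', hσ]
        have h1 : ∀ k, v k ^ gainExponent α =
            r ^ gainExponent α * (r⁻¹ * v k) ^ gainExponent α := fun k => by
          rw [← Real.mul_rpow hr.le (mul_nonneg (inv_nonneg.2 hr.le) (hv k).le),
            mul_inv_cancel_left₀ hr.ne']
        -- Bernoulli replaces r^β by its tangent at 1, making the bound affine in σ as minimax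
        -- requires.
        have h2 := rpow_one_add_le_one_add_mul_self (s := r - 1) (by linarith) hβ.le
          (gainExponent_le_one hα)
        rw [add_sub_cancel] at h2
        calc ∑ k, u k * v k ^ gainExponent α
            = r ^ gainExponent α * ∑ k, u k * (r⁻¹ * v k) ^ gainExponent α := by
              rw [Finset.mul_sum]
              exact Finset.sum_congr rfl fun k _ => by rw [h1]; ring
          _ ≤ r ^ gainExponent α * maxExpectedGain α ρ := by gcongr
          _ ≤ (1 + gainExponent α * (r - 1)) * maxExpectedGain α ρ := by gcongr
          _ = _ := by ring
    refine (iInf_le _ σ).trans (iSup₂_le fun n M => ?_)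
    exact renyiDiv_le_of_forall_sum_rpow_le hα (ρ.re_trace_joint_mul_nonneg M)
      (σ.re_trace_one_kronecker_mul_nonneg M) (ρ.sum_re_trace_joint_mul M) hpos (hσ n M)
  -- The divergence may be infinite, so it is tested against its real upper bounds.
  · refine EReal.le_of_forall_lt_iff_le.1 fun r hr => ?_
    rw [EReal.coe_le_coe_iff, inv_mul_le_iff₀ hβ, Real.log_le_iff_le_exp hpos]
    have : Nonempty (POVM X B) := ⟨POVM.uniform X B⟩
    refine ciSup_le fun M => ?_
    obtain ⟨n, E, μ, hμ, hf, hQ, -, -⟩ := M.exists_eigen_measurement ρ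
    rw [expectedGain, hf]
    exact sum_mul_rpow_le_exp hα (ρ.re_trace_joint_mul_nonneg E)
      (σ.re_trace_one_kronecker_mul_nonneg E) hμ (hQ σ)
      ((le_iSup₂ (f := fun (n : ℕ) (M : POVM (Fin n) (X × B)) => renyiDiv α
        (fun i => (trace (ρ.joint * M.effect i)).re)
        (fun i => (trace ((1 : Matrix X X ℂ) ⊗ₖ σ.mat * M.effect i)).re)) n E).trans hr.le)

/-- Together with the finite loss of the uniform guess, this makes the minimal log-loss a real
number. -/
theorem expectedLogLoss_nonneg (ρ : CQState X B) (M : POVM X B) : 0 ≤ expectedLogLoss ρ M := by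
  rw [expectedLogLoss]
  split_ifs with h
  · obtain ⟨n, E, μ, hμ, hf, -, hle, hsupp⟩ := M.exists_eigen_measurement ρ
    rw [hf, ← EReal.coe_zero, EReal.coe_le_coe_iff, neg_nonneg]
    have : ∀ i, (trace (ρ.joint * E.effect i)).re * Real.log (μ i) ≤
        (trace (ρ.joint * E.effect i)).re * (μ i - 1) := fun i => by
      obtain h0 | h0 := (hμ i).eq_or_lt
      · rw [hsupp h i h0.symm]; simp
      · exact mul_le_mul_of_nonneg_left (Real.log_le_sub_one_of_pos h0)
          (ρ.re_trace_joint_mul_nonneg E i)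
    refine (Finset.sum_le_sum fun i _ => this i).trans ?_
    simp only [mul_sub, mul_one, Finset.sum_sub_distrib, ρ.sum_re_trace_joint_mul]
    linarith
  · exact le_top

theorem expectedLogLoss_of_posDef (ρ : CQState X B) {M : POVM X B} (hM : M.joint.PosDef) :
    expectedLogLoss ρ M = ((-(trace (ρ.joint * cfc Real.log M.joint)).re : ℝ) : EReal) := by
  refine if_pos fun v hv => ?_
  obtain rfl : v = 0 := by
    by_contra hne
    have := hM.dotProduct_mulVec_pos hne
    simp [hv] at this
  exact mulVec_zero _

theorem minExpectedLogLoss_eq (ρ : CQState X B) :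
    minExpectedLogLoss ρ = measuredCondEntropy 1 ρ := by
  have hX := ρ.dist.nonempty
  have h0 : minExpectedLogLoss ρ ≠ ⊥ := ne_bot_of_le_ne_bot EReal.zero_ne_bot
    (le_iInf fun M => expectedLogLoss_nonneg ρ M)
  have htop : minExpectedLogLoss ρ ≠ ⊤ := by
    refine ne_top_of_le_ne_top ?_ (iInf_le _ (POVM.uniform X B))
    rw [expectedLogLoss_of_posDef]
    · exact EReal.coe_ne_top _
    · exact posDef_cqOperator fun x => PosDef.one.smul (by positivity)
  obtain ⟨e, he⟩ : ∃ e : ℝ, minExpectedLogLoss ρ = e :=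
    ⟨_, (EReal.coe_toReal htop h0).symm⟩
  rw [measuredCondEntropy]
  refine le_antisymm ?_ (le_iInf fun M => ?_)
  · rw [he, EReal.le_neg, ← EReal.coe_neg]
    -- For fixed ω, rescaling by r⁻¹ gives the bound -e + log r; the tangent log r ≤ r - 1 yields
    -- these constants.
    obtain ⟨σ, hσ⟩ := exists_density_forall_sum_le ρ (a := -e - 1) (b := 1)
      operatorJensen_log fun ω hω => by
        obtain ⟨σ, r, M, u, v, hr, hσ, hMpos, hu, hv, hf⟩ := exists_density_povm_spectrum ρ hω
        refine ⟨σ, ?_⟩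
        obtain ⟨hω', hM⟩ := hf Real.log
        have hM := hM operatorJensen_log
        have hloss : minExpectedLogLoss ρ ≤ expectedLogLoss ρ M := iInf_le _ M
        rw [he, expectedLogLoss_of_posDef ρ hMpos, EReal.coe_le_coe_iff] at hloss
        have h1 : ∑ k, u k * Real.log (r⁻¹ * v k) = ∑ k, u k * Real.log (v k) - Real.log r := by
          rw [← one_mul (Real.log r), ← hu, Finset.sum_mul, ← Finset.sum_sub_distrib]
          refine Finset.sum_congr rfl fun k _ => ?_
          rw [Real.log_mul (inv_ne_zero hr.ne') (hv k).ne', Real.log_inv]; ring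
        have h2 := Real.log_le_sub_one_of_pos hr
        rw [hω', hσ]
        linarith
    refine (iInf_le _ σ).trans (iSup₂_le fun n M => ?_)
    exact renyiDiv_one_le (ρ.re_trace_joint_mul_nonneg M)
      (σ.re_trace_one_kronecker_mul_nonneg M) (ρ.sum_re_trace_joint_mul M) (hσ n M)
  · rw [expectedLogLoss]
    split_ifs with hsupp
    · rw [EReal.neg_le, ← EReal.coe_neg, neg_neg]
      refine le_iInf fun σ => ?_
      obtain ⟨n, E, μ, hμ, hf, hQ, -, hE⟩ := M.exists_eigen_measurement ρ
      rw [hf]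
      exact (sum_mul_log_le_renyiDiv_one (ρ.re_trace_joint_mul_nonneg E)
        (σ.re_trace_one_kronecker_mul_nonneg E) hμ (ρ.sum_re_trace_joint_mul E) (hQ σ)
        (hE hsupp)).trans
        (le_iSup₂ (f := fun (n : ℕ) (M : POVM (Fin n) (X × B)) => renyiDiv 1
          (fun i => (trace (ρ.joint * M.effect i)).re)
          (fun i => (trace ((1 : Matrix X X ℂ) ⊗ₖ σ.mat * M.effect i)).re)) n E)
    · exact le_top

theorem alphaLeakage_eq (ρ : CQState X B) {α : ℝ≥0∞} (hα : 1 ≤ α) :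
    alphaLeakage α ρ = measuredArimotoInfo α ρ := by
  rw [alphaLeakage, measuredArimotoInfo]
  obtain rfl | hα := hα.eq_or_lt
  · rw [if_pos rfl, priorMinExpectedLogLoss_eq, minExpectedLogLoss_eq]
  · obtain ⟨hp, hlog⟩ := log_priorMaxExpectedGain hα ρ.dist
    rw [if_neg hα.ne', measuredCondEntropy, iInf_measuredRenyiDiv hα, ← EReal.coe_neg,
      ← EReal.coe_sub, EReal.coe_eq_coe_iff,
      Real.log_div (maxExpectedGain_pos hα ρ).ne' hp.ne', mul_sub, hlog]
    ring

end Main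

end QLeakage

theorem mainTheorem2 {X B : Type*} [Fintype X] [DecidableEq X] [Fintype B] [DecidableEq B]
    (ρ : QLeakage.CQState X B) :
    (∀ α : ENNReal, 1 ≤ α →
      QLeakage.alphaLeakage α ρ = QLeakage.measuredArimotoInfo α ρ) ∧
    QLeakage.minExpectedLogLoss ρ = QLeakage.measuredCondEntropy 1 ρ :=
  ⟨fun _ hα => QLeakage.alphaLeakage_eq ρ hα, QLeakage.minExpectedLogLoss_eq ρ⟩
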